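/- For a positive integer $Q$, let $\mathfrak{F}_Q$ be the Farey sequence of order $Q$, that is, the increasing sequence of the reduced fractions in $[0,1]$ with positive denominator at most $Q$. For $r\ge 1$ and $\mathbf{c}=(c_1,\dots,c_r)\in\{0,1\}^r$, let $N_Q^r(\mathbf{c},2)$ be the number of $r$-tuples of consecutive fractions in $\mathfrak{F}_Q$ whose denominators $q_1,\dots,q_r$ satisfy $q_j\equiv c_j\pmod 2$ for $1\le j\le r$, and put $$\rho_Q^r(\mathbf{c},2)=\frac{N_Q^r(\mathbf{c},2)}{\#\mathfrak{F}_Q-(r-1)}.$$ Let $\mathcal{T}=\{(x,y)\in\mathbb{R}^2: x\le 1,\ y\le 1,\ x+y>1\}$. For $(x,y)\in\mathcal{T}$ put $L_{-1}(x,y)=x$, $L_0(x,y)=y$ and, for $j\ge 1$, $k_j(x,y)=\left\lfloor\frac{1+L_{j-2}(x,y)}{L_{j-1}(x,y)}\right\rfloor$ and $L_j(x,y)=k_j(x,y)L_{j-1}(x,y)-L_{j-2}(x,y)$. For a vector $\mathbf{k}=(k_1,\dots,k_s)$ of positive integers let $\mathcal{T}[\mathbf{k}]=\{(x,y)\in\mathcal{T}: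 k_j(x,y)=k_j \text{ for } 1\le j\le s\}$. For $r\ge 3$ let $\mathcal{K}^{r-2}(\mathbf{c},2)$ be the set of the vectors $\mathbf{k}=(k_1,\dots,k_{r-2})$ of positive integers for which there are an integer $Q\ge 1$ and coprime integers $q_1,q_2\le Q$ with $q_1+q_2>Q$ such that, with $q_{j+2}=\left\lfloor\frac{q_j+Q}{q_{j+1}}\right\rfloor q_{j+1}-q_j$ for $1\le j\le r-2$, one has $k_j=\left\lfloor\frac{q_j+Q}{q_{j+1}}\right\rfloor$ for $1\le j\le r-2$ and $q_j\equiv c_j\pmod 2$ for $1\le j\le r$. Then for every $r\ge 1$ and every $\mathbf{c}\in\{0,1\}^r$ the limit $\rho^r(\mathbf{c},2)=\lim_{Q\to\infty}\rho_Q^r(\mathbf{c},2)$ exists. Furthermore, $\rho^1(0;2)=1/3$, $\rho^1(1;2)=2/3$, $\rho^2(0,1;2)=\rho^2(1,0;2)=\rho^2(1,1;2)=1/3$, and for every $r\ge 3$ and $\mathbf{c}\in\{0,1\}^r$ $$\rho^r(\mathbf{c},2)=\frac23\sum_{\mathbf{k}\in\mathcal{K}^{r-2}(\mathbf{c},2)}\mathrm{Area}\big(\mathcal{T}[\mathbf{k}]\big),$$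 where the series on the right converges. -/

import Mathlib

open Filter Topology MeasureTheory

/-- The Farey sequence of order `Q`, as a set: the rationals in `[0, 1]` whose (reduced, positive)
denominator is at most `Q`. -/
def fareySet (Q : ℕ) : Set ℚ := {x | 0 ≤ x ∧ x ≤ 1 ∧ x.den ≤ Q}

theorem fareySet_finite (Q : ℕ) : (fareySet Q).Finite := by
  apply ((Finset.range (Q + 1) ×ˢ Finset.range (Q + 1)).image
    (fun p : ℕ × ℕ => (p.1 : ℚ) / (p.2 : ℚ))).finite_toSet.subset
  rintro x ⟨h0, h1, hQ⟩
  have hn : 0 ≤ x.num := Rat.num_nonneg.mpr h0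
  have hle : x.num ≤ x.den := Rat.num_le_denom_iff.mpr h1
  simp only [Finset.coe_image, Set.mem_image, Finset.mem_coe, Finset.mem_product, Finset.mem_range]
  refine ⟨(x.num.toNat, x.den), ⟨by omega, by omega⟩, ?_⟩
  have h : ((x.num.toNat : ℕ) : ℚ) = (x.num : ℚ) := by
    exact_mod_cast congrArg (Int.cast : ℤ → ℚ) (Int.toNat_of_nonneg hn)
  simp only [h]
  exact Rat.num_div_den x

/-- The `r`-tuples of consecutive elements, in increasing order, of the Farey sequence of
order `Q`. -/
def consecutiveFractions (Q r : ℕ) : Set (Fin r → ℚ) :=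
  {f | (∀ i, f i ∈ fareySet Q) ∧
    ∀ i j : Fin r, (i : ℕ) + 1 = (j : ℕ) →
      f i < f j ∧ ∀ x ∈ fareySet Q, ¬ (f i < x ∧ x < f j)}

/-- The number of `r`-tuples of consecutive Farey fractions of order `Q` whose denominators
are congruent to `c` modulo `d`, component by component. -/
noncomputable def parityCount (Q d : ℕ) {r : ℕ} (c : Fin r → ℕ) : ℕ :=
  {f ∈ consecutiveFractions Q r | ∀ i, (f i).den ≡ c i [MOD d]}.ncard

/-- The proportion, among the `r`-tuples of consecutive Farey fractions of order `Q`, of those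
whose denominators are congruent to `c` modulo `d`. -/
noncomputable def parityProportion (Q d : ℕ) {r : ℕ} (c : Fin r → ℕ) : ℝ :=
  (parityCount Q d c : ℝ) / (((fareySet Q).ncard : ℝ) - ((r : ℝ) - 1))

/-- The Farey triangle, with vertices `(1, 0)`, `(1, 1)`, `(0, 1)`; the side joining `(1, 0)` and
`(0, 1)` is left out. -/
def fareyTriangle : Set (ℝ × ℝ) := {p | p.1 ≤ 1 ∧ p.2 ≤ 1 ∧ 1 < p.1 + p.2}

/-- The sequence `L`, with indices shifted by one: `fareyL x y n` is `L_{n-1}(x, y)`. -/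
noncomputable def fareyL (x y : ℝ) : ℕ → ℝ
  | 0 => x
  | 1 => y
  | n + 2 => (⌊(1 + fareyL x y n) / fareyL x y (n + 1)⌋ : ℝ) * fareyL x y (n + 1) - fareyL x y n

/-- The integer `k_{j+1}(x, y) = ⌊(1 + L_{j-1}(x, y)) / L_j(x, y)⌋`, for `j = 0, 1, …`. -/
noncomputable def fareyIndex (x y : ℝ) (j : ℕ) : ℤ :=
  ⌊(1 + fareyL x y j) / fareyL x y (j + 1)⌋

/-- The region `T[k]` of the Farey triangle on which `(k_1(x, y), …, k_s(x, y)) = k`. -/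
def fareyRegion {s : ℕ} (k : Fin s → ℕ) : Set (ℝ × ℝ) :=
  {p ∈ fareyTriangle | ∀ j : Fin s, fareyIndex p.1 p.2 j = (k j : ℤ)}

/-- The area (planar Lebesgue measure) of `T[k]`. -/
noncomputable def fareyArea {s : ℕ} (k : Fin s → ℕ) : ℝ := (volume (fareyRegion k)).toReal

/-- The integer points `(q', q'')` with coprime coordinates of the Farey triangle scaled
by `Q`. -/
def generators (Q : ℕ) : Set (ℕ × ℕ) :=
  {p | p.1 ≤ Q ∧ p.2 ≤ Q ∧ Q < p.1 + p.2 ∧ Nat.Coprime p.1 p.2}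

/-- The denominators generated by `(q', q'')`, numbered from `0`: each new one is
`q_{j+2} = ⌊(q_j + Q) / q_{j+1}⌋ q_{j+1} - q_j`. -/
def generatedDen (Q q' q'' : ℕ) : ℕ → ℤ
  | 0 => q'
  | 1 => q''
  | n + 2 => ((generatedDen Q q' q'' n + Q) / generatedDen Q q' q'' (n + 1))
      * generatedDen Q q' q'' (n + 1) - generatedDen Q q' q'' n

/-- The integers `⌊(q_j + Q) / q_{j+1}⌋` generated by `(q', q'')`, numbered from `0`. -/
def generatedIndex (Q q' q'' : ℕ) (j : ℕ) : ℤ :=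
  (generatedDen Q q' q'' j + Q) / generatedDen Q q' q'' (j + 1)

/-- The set `K^{r-2}(c, d)`: the vectors `k` with `r - 2` components generated, for some `Q ≥ 1`, by
some coprime integer point `(q', q'')` of the scaled Farey triangle whose generated `r`-tuple of
denominators is congruent to `c` modulo `d`. -/
def parityIndices (d : ℕ) {r : ℕ} (c : Fin r → ℕ) : Set (Fin (r - 2) → ℕ) :=
  {k | ∃ Q : ℕ, 1 ≤ Q ∧ ∃ p ∈ generators Q,
    (∀ j : Fin (r - 2), generatedIndex Q p.1 p.2 j = (k j : ℤ)) ∧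
    ∀ i : Fin r, generatedDen Q p.1 p.2 i ≡ (c i : ℤ) [ZMOD (d : ℤ)]}

/-! Neighbouring fractions have determinant 1, so a fraction of `[0, 1)` is determined by its own
denominator and that of its successor; the pairs that occur are the coprime points of the triangle
scaled by `Q` (`bijOn_fareyStart_generators`). All later denominators follow by the recursion
(`FareyNext.den_eq`), which after division by `Q` is the recursion of `fareyL`. Hence the vector of
indices says which region `T[k]` contains the scaled point, and this vector with the parities of the
first two denominators fixes all later parities. For `r ≥ 2`, counting tuples is therefore, up to a
bounded error at the fraction 1, counting coprime points of one parity class in `Q • ⋃ T[k]`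
(`parityGenerators_eq_latticeSet`).

That union may be infinite, yet its frontier lies in countably many lines, so lattice points in it
are counted by its area. Möbius inversion with dominated convergence shows that coprime points in
each of the three classes other than (even, even) have the same density `parityDensity`
(`tendsto_ncard_parityCoprime`). The triangle has area 1/2, so the Farey sequence has about `3 *
(1/2) * parityDensity * Q ^ 2` terms; in the quotient the density cancels and leaves 2/3 of the area
of the union, which countable additivity turns into the series. -/

/-! ### Neighbours and determinants -/

/-- `x` and `y` are neighbours, in this order, among the rationals with denominator at most `Q`. -/
def FareyNext (Q : ℕ) (x y : ℚ) : Prop :=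
  x.den ≤ Q ∧ y.den ≤ Q ∧ Q < x.den + y.den ∧ y.num * x.den - x.num * y.den = 1

theorem FareyNext.lt {Q : ℕ} {x y : ℚ} (h : FareyNext Q x y) : x < y := by
  rw [Rat.lt_iff]
  have := h.2.2.2
  linarith

/-- By the determinant relation the denominator of a fraction strictly between is a combination of
the two outer denominators with positive integer coefficients, hence at least their sum, which
exceeds `Q`. -/
theorem FareyNext.not_between {Q : ℕ} {x y z : ℚ} (h : FareyNext Q x y) (hz : z.den ≤ Q) :
    ¬ (x < z ∧ z < y) := by
  rintro ⟨h1, h2⟩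
  rw [Rat.lt_iff] at h1 h2
  obtain ⟨-, -, hQ, hd⟩ := h
  have hx : (0 : ℤ) < x.den := by exact_mod_cast x.pos
  have hy : (0 : ℤ) < y.den := by exact_mod_cast y.pos
  have e : (z.den : ℤ) = x.den * (y.num * z.den - z.num * y.den)
      + y.den * (z.num * x.den - x.num * z.den) := by
    linear_combination (-(z.den : ℤ)) * hd
  have hz' : (z.den : ℤ) ≤ Q := by exact_mod_cast hz
  have hQ' : (Q : ℤ) < x.den + y.den := by exact_mod_cast hQ
  nlinarith

theorem FareyNext.right_unique {Q : ℕ} {x y z : ℚ} (h : FareyNext Q x y) (h' : FareyNext Q x z) :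
    y = z := by
  rcases lt_trichotomy y z with hlt | heq | hgt
  · exact absurd ⟨h.lt, hlt⟩ (h'.not_between h.2.1)
  · exact heq
  · exact absurd ⟨h'.lt, hgt⟩ (h.not_between h'.2.1)

theorem FareyNext.left_unique {Q : ℕ} {x y z : ℚ} (h : FareyNext Q x z) (h' : FareyNext Q y z) :
    x = y := by
  rcases lt_trichotomy x y with hlt | heq | hgt
  · exact absurd ⟨hlt, h'.lt⟩ (h.not_between h'.1)
  · exact heq
  · exact absurd ⟨hgt, h.lt⟩ (h'.not_between h.1)

theorem exists_rat_num_den {a b : ℤ} (hb : 0 < b) (h : IsCoprime a b) :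
    ∃ x : ℚ, x.num = a ∧ (x.den : ℤ) = b := by
  lift b to ℕ using hb.le
  exact ⟨⟨a, b, by omega, by simpa [Int.isCoprime_iff_gcd_eq_one, Int.gcd] using h⟩, rfl, rfl⟩

theorem exists_fareyNext {Q : ℕ} {x : ℚ} (hx : x.den ≤ Q) : ∃ y, FareyNext Q x y := by
  have hpos : (0 : ℤ) < x.den := by exact_mod_cast x.pos
  have hcop : IsCoprime x.num (x.den : ℤ) := by
    rw [Int.isCoprime_iff_gcd_eq_one]
    simpa [Int.gcd] using x.reduced
  obtain ⟨u, v, huv⟩ := hcop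
  have hdiv := Int.mul_ediv_add_emod (Q + u : ℤ) x.den
  have hm0 := Int.emod_nonneg (Q + u : ℤ) hpos.ne'
  have hm1 := Int.emod_lt_of_pos (Q + u : ℤ) hpos
  set t := (Q + u : ℤ) / x.den
  set m := (Q + u : ℤ) % x.den
  have hx' : (x.den : ℤ) ≤ Q := by exact_mod_cast hx
  -- The denominators `b` admitting an integer `a` with `a * x.den - x.num * b = 1` form the class
  -- of `-u` modulo `x.den`; `Q - m` is its representative in `(Q - x.den, Q]`.
  have key : (v + x.num * t) * x.den - x.num * (Q - m) = 1 := by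
    linear_combination huv + x.num * hdiv
  obtain ⟨y, hy1, hy2⟩ := exists_rat_num_den (a := v + x.num * t) (b := Q - m) (by omega)
    ⟨x.den, -x.num, by linear_combination key⟩
  refine ⟨y, hx, by omega, by omega, ?_⟩
  rw [hy1, hy2, key]

open Classical in
/-- The successor of `x` among the rationals with denominator at most `Q`. -/
noncomputable def fareySucc (Q : ℕ) (x : ℚ) : ℚ :=
  if h : x.den ≤ Q then (exists_fareyNext h).choose else x

theorem fareyNext_fareySucc {Q : ℕ} {x : ℚ} (hx : x.den ≤ Q) :
    FareyNext Q x (fareySucc Q x) := by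
  rw [fareySucc, dif_pos hx]
  exact (exists_fareyNext hx).choose_spec

theorem fareySucc_iterate_den_le {Q : ℕ} {x : ℚ} (hx : x.den ≤ Q) (n : ℕ) :
    ((fareySucc Q)^[n] x).den ≤ Q := by
  induction n with
  | zero => exact hx
  | succ n ih =>
    rw [Function.iterate_succ_apply']
    exact (fareyNext_fareySucc ih).2.1

theorem fareyNext_iterate {Q : ℕ} {x : ℚ} (hx : x.den ≤ Q) (n : ℕ) :
    FareyNext Q ((fareySucc Q)^[n] x) ((fareySucc Q)^[n + 1] x) := by
  rw [Function.iterate_succ_apply']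
  exact fareyNext_fareySucc (fareySucc_iterate_den_le hx n)

/-- Subtracting the two determinant relations shows that `y.den` divides `x.den + z.den`. The
quotient is the stated floor because `z.den` lies in `(Q - y.den, Q]`. -/
theorem FareyNext.den_eq {Q : ℕ} {x y z : ℚ} (h : FareyNext Q x y) (h' : FareyNext Q y z) :
    (z.den : ℤ) = ((x.den + Q : ℤ) / y.den) * y.den - x.den := by
  obtain ⟨-, -, hxy, e⟩ := h
  obtain ⟨-, hz, hyz, e'⟩ := h'
  have hy : (0 : ℤ) < y.den := by exact_mod_cast y.pos
  have hcop : IsCoprime (y.den : ℤ) y.num := by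
    rw [isCoprime_comm, Int.isCoprime_iff_gcd_eq_one]
    simpa [Int.gcd] using y.reduced
  obtain ⟨k, hk⟩ : (y.den : ℤ) ∣ z.den + x.den :=
    hcop.dvd_of_dvd_mul_right ⟨z.num + x.num, by linear_combination e - e'⟩
  have : (x.den + Q : ℤ) / y.den = k := by
    rw [Int.ediv_eq_iff_of_pos hy]
    constructor <;> nlinarith
  rw [this]
  linear_combination hk

theorem den_fareySucc_iterate {Q : ℕ} {x : ℚ} (hx : x.den ≤ Q) (n : ℕ) :
    (((fareySucc Q)^[n] x).den : ℤ) = generatedDen Q x.den (fareySucc Q x).den n := by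
  induction n using Nat.twoStepInduction with
  | zero => rfl
  | one => rfl
  | more n ih1 ih2 =>
    rw [generatedDen, ← ih1, ← ih2]
    exact (fareyNext_iterate hx n).den_eq (fareyNext_iterate hx (n + 1))

/-! ### Pairs of denominators as coordinates -/

/-- The fractions in `[0, 1)` with denominator at most `Q`. -/
def fareyStart (Q : ℕ) : Set ℚ := {x | 0 ≤ x ∧ x < 1 ∧ x.den ≤ Q}

theorem fareyStart_subset (Q : ℕ) : fareyStart Q ⊆ fareySet Q := fun _ h => ⟨h.1, h.2.1.le, h.2.2⟩

theorem fareyStart_finite (Q : ℕ) : (fareyStart Q).Finite :=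
  (fareySet_finite Q).subset (fareyStart_subset Q)

theorem fareySet_eq_insert {Q : ℕ} (hQ : 1 ≤ Q) : fareySet Q = insert 1 (fareyStart Q) := by
  ext x
  constructor
  · rintro ⟨h0, h1, h2⟩
    rcases h1.eq_or_lt with h | h
    · exact Or.inl h
    · exact Or.inr ⟨h0, h, h2⟩
  · rintro (rfl | h)
    · exact ⟨zero_le_one, le_rfl, by simpa using hQ⟩
    · exact fareyStart_subset Q h

theorem ncard_fareySet {Q : ℕ} (hQ : 1 ≤ Q) : (fareySet Q).ncard = (fareyStart Q).ncard + 1 := by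
  rw [fareySet_eq_insert hQ]
  exact Set.ncard_insert_of_notMem (fun h => absurd h.2.1 (lt_irrefl _)) (fareyStart_finite Q)

/-- The determinant relation fixes the numerator modulo the denominator, and `[0, 1)` contains one
representative of each residue; hence the endpoint 1 is left out. -/
theorem bijOn_fareyStart_generators (Q : ℕ) :
    Set.BijOn (fun x : ℚ => (x.den, (fareySucc Q x).den)) (fareyStart Q) (generators Q) := by
  refine ⟨?_, ?_, ?_⟩
  · rintro x ⟨-, -, hx⟩
    obtain ⟨h1, h2, h3, h4⟩ := fareyNext_fareySucc hx
    refine ⟨h1, h2, h3, ?_⟩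
    rw [← Nat.isCoprime_iff_coprime]
    exact ⟨(fareySucc Q x).num, -x.num, by linear_combination h4⟩
  · rintro x ⟨hx0, hx1, hx⟩ y ⟨hy0, hy1, hy⟩ hxy
    simp only [Prod.mk.injEq] at hxy
    obtain ⟨-, -, -, h4⟩ := fareyNext_fareySucc hx
    obtain ⟨-, -, -, h4'⟩ := fareyNext_fareySucc hy
    rw [← hxy.1, ← hxy.2] at h4'
    have hcop : IsCoprime (x.den : ℤ) ((fareySucc Q x).den : ℤ) :=
      ⟨(fareySucc Q x).num, -x.num, by linear_combination h4⟩
    have hdvd : (x.den : ℤ) ∣ x.num - y.num :=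
      hcop.dvd_of_dvd_mul_right ⟨(fareySucc Q x).num - (fareySucc Q y).num, by
        linear_combination h4' - h4⟩
    have a1 : 0 ≤ x.num := Rat.num_nonneg.mpr hx0
    have a2 : 0 ≤ y.num := Rat.num_nonneg.mpr hy0
    have a3 : x.num < x.den := Rat.num_lt_denom_iff.mpr hx1
    have a4 : y.num < x.den := hxy.1 ▸ Rat.num_lt_denom_iff.mpr hy1
    have : x.num - y.num = 0 := Int.eq_zero_of_abs_lt_dvd hdvd (by rw [abs_lt]; omega)
    exact Rat.ext (by omega) hxy.1
  · rintro ⟨a, b⟩ ⟨ha, hb, hab, hcop⟩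
    simp only at ha hb hab hcop
    have ha0 : (0 : ℤ) < a := by omega
    have hb0 : (0 : ℤ) < b := by omega
    obtain ⟨u, v, huv⟩ := Nat.isCoprime_iff_coprime.mpr hcop
    -- From `u * a + v * b = 1`, the numerator over `a` must be congruent to `-v`; reducing it to
    -- `[0, a)` shifts the numerator over `b` by `t * b`.
    have hdiv := Int.mul_ediv_add_emod (-v) a
    have hm0 := Int.emod_nonneg (-v) ha0.ne'
    have hm1 := Int.emod_lt_of_pos (-v) ha0
    set t := (-v) / (a : ℤ)
    set m := (-v) % (a : ℤ)
    have key : (u - t * b) * a - m * b = 1 := by linear_combination huv - b * hdiv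
    obtain ⟨x, hx1, hx2⟩ := exists_rat_num_den (a := m) (b := a) ha0
      ⟨-b, u - t * b, by linear_combination key⟩
    obtain ⟨y, hy1, hy2⟩ := exists_rat_num_den (a := u - t * b) (b := b) hb0
      ⟨a, -m, by linear_combination key⟩
    have hx3 : x.den = a := by exact_mod_cast hx2
    have hy3 : y.den = b := by exact_mod_cast hy2
    have hn : FareyNext Q x y := ⟨by omega, by omega, by omega, by rw [hx1, hx2, hy1, hy2, key]⟩
    have hs : fareySucc Q x = y := (fareyNext_fareySucc hn.1).right_unique hn
    refine ⟨x, ⟨Rat.num_nonneg.mp (by omega), Rat.num_lt_denom_iff.mp (by omega), by omega⟩, ?_⟩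
    simp only [hs, hx3, hy3]

theorem generators_finite (Q : ℕ) : (generators Q).Finite :=
  (bijOn_fareyStart_generators Q).image_eq ▸ (fareyStart_finite Q).image _

theorem ncard_fareySet_eq_generators {Q : ℕ} (hQ : 1 ≤ Q) :
    (fareySet Q).ncard = (generators Q).ncard + 1 := by
  rw [ncard_fareySet hQ, ← (bijOn_fareyStart_generators Q).image_eq,
    Set.InjOn.ncard_image (bijOn_fareyStart_generators Q).injOn]

/-! ### Tuples of fractions versus generators -/

/-- The generators whose generated `r`-tuple of denominators is congruent to `c` modulo `d`. -/
def parityGenerators (Q d : ℕ) {r : ℕ} (c : Fin r → ℕ) : Set (ℕ × ℕ) :=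
  {p ∈ generators Q | ∀ i : Fin r, generatedDen Q p.1 p.2 i ≡ (c i : ℤ) [ZMOD (d : ℤ)]}

/-- The fractions in `[0, 1)` at which a tuple of neighbours with denominators congruent to `c`
modulo `d` begins. -/
def parityStart (Q d : ℕ) {r : ℕ} (c : Fin r → ℕ) : Set ℚ :=
  {x ∈ fareyStart Q | ∀ i : Fin r, ((fareySucc Q)^[i] x).den ≡ c i [MOD d]}

theorem parityStart_finite (Q d : ℕ) {r : ℕ} (c : Fin r → ℕ) : (parityStart Q d c).Finite :=
  (fareyStart_finite Q).subset fun _ h => h.1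

theorem ncard_parityGenerators (Q d : ℕ) {r : ℕ} (c : Fin r → ℕ) :
    (parityGenerators Q d c).ncard = (parityStart Q d c).ncard := by
  have hb := bijOn_fareyStart_generators Q
  have key : ∀ x ∈ fareyStart Q,
      (∀ i : Fin r, ((fareySucc Q)^[i] x).den ≡ c i [MOD d]) ↔
      ∀ i : Fin r, generatedDen Q x.den (fareySucc Q x).den i ≡ (c i : ℤ) [ZMOD (d : ℤ)] := by
    intro x hx
    refine forall_congr' fun i => ?_
    rw [← den_fareySucc_iterate hx.2.2, Int.natCast_modEq_iff]
  have : parityGenerators Q d c =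
      (fun x : ℚ => (x.den, (fareySucc Q x).den)) '' parityStart Q d c := by
    ext p
    constructor
    · rintro ⟨hp, hc⟩
      obtain ⟨x, hx, rfl⟩ := hb.surjOn hp
      exact ⟨x, ⟨hx, (key x hx).mpr hc⟩, rfl⟩
    · rintro ⟨x, ⟨hx, hc⟩, rfl⟩
      exact ⟨hb.mapsTo hx, (key x hx).mp hc⟩
  rw [this, Set.InjOn.ncard_image (hb.injOn.mono fun _ h => h.1)]

theorem fareySucc_le_one {Q : ℕ} {x : ℚ} (hx : x.den ≤ Q) (h1 : x < 1) : fareySucc Q x ≤ 1 := by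
  by_contra! h
  exact (fareyNext_fareySucc hx).not_between (z := 1) (x.pos.trans_le hx) ⟨h1, h⟩

theorem consecutiveFractions_eq_iterate {Q r : ℕ} {f : Fin r → ℚ}
    (hf : f ∈ consecutiveFractions Q r) (hr : 0 < r) (n : ℕ) (hn : n < r) :
    f ⟨n, hn⟩ = (fareySucc Q)^[n] (f ⟨0, hr⟩) := by
  induction n with
  | zero => rfl
  | succ n ih =>
    have hn' : n < r := by omega
    obtain ⟨hlt, hbt⟩ := hf.2 ⟨n, hn'⟩ ⟨n + 1, hn⟩ rfl
    have hmem := hf.1 ⟨n, hn'⟩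
    have hmem' := hf.1 ⟨n + 1, hn⟩
    rw [Function.iterate_succ_apply', ← ih hn']
    have hnext := fareyNext_fareySucc hmem.2.2
    have hs : fareySucc Q (f ⟨n, hn'⟩) ∈ fareySet Q :=
      ⟨hmem.1.trans hnext.lt.le, fareySucc_le_one hmem.2.2 (hlt.trans_le hmem'.2.1), hnext.2.1⟩
    apply le_antisymm
    · by_contra! h
      exact hbt _ hs ⟨hnext.lt, h⟩
    · by_contra! h
      exact hnext.not_between hmem'.2.2 ⟨hlt, h⟩

theorem parityTuples_injOn (Q d : ℕ) {r : ℕ} (hr : 0 < r) (c : Fin r → ℕ) :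
    Set.InjOn (fun f : Fin r → ℚ => f ⟨0, hr⟩)
      {f ∈ consecutiveFractions Q r | ∀ i, (f i).den ≡ c i [MOD d]} := by
  rintro f ⟨hf, -⟩ g ⟨hg, -⟩ hfg
  funext ⟨i, hi⟩
  rw [consecutiveFractions_eq_iterate hf hr, consecutiveFractions_eq_iterate hg hr]
  exact congrArg _ hfg

/-- A tuple can begin at 1 only when `r = 1`; this is the sole start outside `[0, 1)`. -/
theorem parityTuples_image_subset (Q d : ℕ) {r : ℕ} (hr : 0 < r) (c : Fin r → ℕ) :
    (fun f : Fin r → ℚ => f ⟨0, hr⟩) ''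
      {f ∈ consecutiveFractions Q r | ∀ i, (f i).den ≡ c i [MOD d]} ⊆
      insert 1 (parityStart Q d c) := by
  rintro _ ⟨f, ⟨hf, hc⟩, rfl⟩
  have h0 := hf.1 ⟨0, hr⟩
  rcases h0.2.1.eq_or_lt with h | h
  · exact Or.inl h
  · refine Or.inr ⟨⟨h0.1, h, h0.2.2⟩, fun i => ?_⟩
    rw [← consecutiveFractions_eq_iterate hf hr i i.2]
    exact hc i

theorem parityCount_le {Q d r : ℕ} (hr : 0 < r) (c : Fin r → ℕ) :
    parityCount Q d c ≤ (parityGenerators Q d c).ncard + 1 := by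
  rw [ncard_parityGenerators, parityCount,
    ← Set.InjOn.ncard_image (parityTuples_injOn Q d hr c)]
  exact (Set.ncard_le_ncard (parityTuples_image_subset Q d hr c)
    ((parityStart_finite Q d c).insert 1)).trans (Set.ncard_insert_le _ _)

theorem fareySucc_iterate_injOn (Q n : ℕ) : Set.InjOn ((fareySucc Q)^[n]) {x | x.den ≤ Q} := by
  induction n with
  | zero => exact fun _ _ _ _ h => h
  | succ n ih =>
    intro x hx y hy h
    refine ih hx hy ?_
    have h1 := fareyNext_iterate hx n
    have h2 := fareyNext_iterate hy n
    rw [h] at h1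
    exact h1.left_unique h2

/-- A start fails to give a tuple inside `[0, 1]` only if its chain of successors reaches 1 in fewer
than `r` steps. Successors are injective, so each number of steps accounts for at most one such
start. -/
theorem le_parityCount {Q d r : ℕ} (hr : 0 < r) (c : Fin r → ℕ) :
    (parityGenerators Q d c).ncard ≤ parityCount Q d c + r := by
  classical
  rw [ncard_parityGenerators, parityCount,
    ← Set.InjOn.ncard_image (parityTuples_injOn Q d hr c)]
  set I := (fun f : Fin r → ℚ => f ⟨0, hr⟩) ''
      {f ∈ consecutiveFractions Q r | ∀ i, (f i).den ≡ c i [MOD d]} with hI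
  have hIfin : I.Finite := ((parityStart_finite Q d c).insert 1).subset
    (parityTuples_image_subset Q d hr c)
  -- `g n` is the only fraction that reaches 1 after `n` steps; the default 0 is harmless, since
  -- only an upper bound for the exceptional starts is needed.
  let g : ℕ → ℚ := fun n => if h : ∃ x : ℚ, x.den ≤ Q ∧ (fareySucc Q)^[n] x = 1 then h.choose else 0
  have hsub : parityStart Q d c ⊆ I ∪ ((Finset.range r).image g : Finset ℚ) := by
    rintro x ⟨⟨h0, h1, hx⟩, hc⟩
    by_cases hex : ∃ n < r, (fareySucc Q)^[n] x = 1
    · obtain ⟨n, hn, h⟩ := hex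
      right
      have hex' : ∃ x : ℚ, x.den ≤ Q ∧ (fareySucc Q)^[n] x = 1 := ⟨x, hx, h⟩
      simp only [Finset.coe_image, Set.mem_image, Finset.mem_coe, Finset.mem_range]
      refine ⟨n, hn, ?_⟩
      simp only [g, dif_pos hex']
      exact fareySucc_iterate_injOn Q n hex'.choose_spec.1 hx (hex'.choose_spec.2.trans h.symm)
    · left
      push Not at hex
      -- A chain cannot jump over 1, so one that avoids 1 stays below it.
      have hlt : ∀ n < r, 0 ≤ (fareySucc Q)^[n] x ∧ (fareySucc Q)^[n] x < 1 := by
        intro n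
        induction n with
        | zero => exact fun _ => ⟨h0, h1⟩
        | succ n ih =>
          intro hn
          obtain ⟨i1, i2⟩ := ih (by omega)
          refine ⟨i1.trans (fareyNext_iterate hx n).lt.le, lt_of_le_of_ne ?_ (hex _ hn)⟩
          rw [Function.iterate_succ_apply']
          exact fareySucc_le_one (fareySucc_iterate_den_le hx n) i2
      refine ⟨fun i => (fareySucc Q)^[i] x, ⟨⟨fun i => ?_, fun i j hij => ?_⟩, hc⟩, rfl⟩
      · exact ⟨(hlt i i.2).1, (hlt i i.2).2.le, fareySucc_iterate_den_le hx i⟩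
      · have := fareyNext_iterate hx i
        rw [hij] at this
        exact ⟨this.lt, fun y hy => this.not_between hy.2.2⟩
  refine (Set.ncard_le_ncard hsub (hIfin.union (Finset.finite_toSet _))).trans
    ((Set.ncard_union_le _ _).trans (Nat.add_le_add_left ?_ _))
  rw [Set.ncard_coe_finset]
  exact Finset.card_image_le.trans (Finset.card_range r).le

/-! ### Lattice points in dilated regions -/

/-- The points with natural coordinates that satisfy `C` and lie in `Q • A`. -/
def latticeSet (A : Set (ℝ × ℝ)) (C : ℕ × ℕ → Prop) (Q : ℕ) : Set (ℕ × ℕ) :=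
  {p | C p ∧ ((p.1 : ℝ) / Q, (p.2 : ℝ) / Q) ∈ A}

/-- A measurable subset of `(0, 1]²` whose frontier has measure zero. -/
structure JordanRegion (A : Set (ℝ × ℝ)) : Prop where
  subset : A ⊆ Set.Ioc 0 1 ×ˢ Set.Ioc 0 1
  measurable : MeasurableSet A
  frontier : volume (frontier A) = 0

theorem JordanRegion.mem_bounds {A : Set (ℝ × ℝ)} (hA : JordanRegion A) {C : ℕ × ℕ → Prop} {Q : ℕ}
    {p : ℕ × ℕ} (hp : p ∈ latticeSet A C Q) :
    1 ≤ p.1 ∧ p.1 ≤ Q ∧ 1 ≤ p.2 ∧ p.2 ≤ Q := by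
  obtain ⟨⟨h1, h2⟩, h3, h4⟩ := hA.subset hp.2
  simp only at h1 h2 h3 h4
  -- For `Q = 0` both quotients are 0 by convention, which `(0, 1]` excludes.
  have hQ : (0 : ℝ) < Q := by
    by_contra h
    have : (Q : ℝ) = 0 := le_antisymm (not_lt.mp h) (Nat.cast_nonneg _)
    rw [this, div_zero] at h1
    exact lt_irrefl _ h1
  rw [div_pos_iff_of_pos_right hQ] at h1 h3
  rw [div_le_one hQ] at h2 h4
  refine ⟨?_, by exact_mod_cast h2, ?_, by exact_mod_cast h4⟩ <;>
    rw [Nat.one_le_iff_ne_zero, ← Nat.pos_iff_ne_zero] <;> assumption_mod_cast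

theorem JordanRegion.latticeSet_finite {A : Set (ℝ × ℝ)} (hA : JordanRegion A) (C : ℕ × ℕ → Prop)
    (Q : ℕ) : (latticeSet A C Q).Finite :=
  ((Set.finite_Icc 1 Q).prod (Set.finite_Icc 1 Q)).subset fun p hp => by
    obtain ⟨h1, h2, h3, h4⟩ := hA.mem_bounds hp
    exact ⟨⟨h1, h2⟩, h3, h4⟩

/-- Dividing the coordinates by `a` and `b` turns the sublattice into the full lattice and the area
into `volume.real A / (a * b)`; the lattice-point count for bounded sets with null frontier then
applies. -/
theorem tendsto_ncard_latticeSet_dvd {A : Set (ℝ × ℝ)} (hA : JordanRegion A) {a b : ℕ}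
    (ha : 0 < a) (hb : 0 < b) :
    Tendsto (fun Q : ℕ => ((latticeSet A (fun p => a ∣ p.1 ∧ b ∣ p.2) Q).ncard : ℝ) / Q ^ 2) atTop
      (𝓝 (volume.real A / (a * b))) := by
  have ha' : (0 : ℝ) < a := by exact_mod_cast ha
  have hb' : (0 : ℝ) < b := by exact_mod_cast hb
  let D : Fin 2 → ℝ := ![a, b]
  have hD : ∀ i, D i ≠ 0 := by
    intro i
    fin_cases i
    · exact ha'.ne'
    · exact hb'.ne'
  let h : (Fin 2 → ℝ) ≃ₜ (Fin 2 → ℝ) := Homeomorph.piCongrRight fun i => Homeomorph.mulLeft₀ (D i) (hD i)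
  let A' : Set (Fin 2 → ℝ) := Homeomorph.finTwoArrow ⁻¹' A
  have hvol : ∀ B : Set (ℝ × ℝ), MeasurableSet B →
      volume (h ⁻¹' (Homeomorph.finTwoArrow ⁻¹' B)) = ENNReal.ofReal |((a : ℝ) * b)⁻¹| * volume B := by
    intro B hB
    have hdet : LinearMap.det (Matrix.toLin' (Matrix.diagonal D)) = (a : ℝ) * b := by
      simp [D, Matrix.det_diagonal, Fin.prod_univ_two]
    have h1 : h ⁻¹' (Homeomorph.finTwoArrow ⁻¹' B) =
        Matrix.toLin' (Matrix.diagonal D) ⁻¹' (Homeomorph.finTwoArrow ⁻¹' B) := by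
      congr 1
      funext v
      ext i
      simp [h, Matrix.mulVec_diagonal]
    rw [h1, Measure.addHaar_preimage_linearMap volume (by rw [hdet]; positivity), hdet]
    congr 1
    exact (volume_preserving_finTwoArrow ℝ).measure_preimage hB.nullMeasurableSet
  have hs1 : Bornology.IsBounded (h ⁻¹' A') := by
    refine (Metric.isBounded_Icc (0 : Fin 2 → ℝ) 1).subset fun v hv => ?_
    obtain ⟨⟨h1, h2⟩, h3, h4⟩ := hA.subset hv
    change 0 < (a : ℝ) * v 0 at h1
    change (a : ℝ) * v 0 ≤ 1 at h2
    change 0 < (b : ℝ) * v 1 at h3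
    change (b : ℝ) * v 1 ≤ 1 at h4
    have ha1 : (1 : ℝ) ≤ a := by exact_mod_cast ha
    have hb1 : (1 : ℝ) ≤ b := by exact_mod_cast hb
    have p0 : 0 < v 0 := pos_of_mul_pos_right h1 ha'.le
    have p1 : 0 < v 1 := pos_of_mul_pos_right h3 hb'.le
    constructor <;> intro i <;> fin_cases i <;> simp <;> nlinarith
  have hs2 : MeasurableSet (h ⁻¹' A') :=
    h.measurable (Homeomorph.finTwoArrow.measurable hA.measurable)
  have hs3 : volume (_root_.frontier (h ⁻¹' A')) = 0 := by
    rw [← h.preimage_frontier, ← Homeomorph.preimage_frontier, hvol _ isClosed_frontier.measurableSet,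
      hA.frontier, mul_zero]
  have key := tendsto_card_div_pow_atTop_volume (h ⁻¹' A') hs1 hs2 hs3
  have hlim : volume.real (h ⁻¹' A') = volume.real A / (a * b) := by
    rw [measureReal_def, hvol A hA.measurable, ENNReal.toReal_mul, ENNReal.toReal_ofReal (abs_nonneg _),
      abs_of_pos (by positivity), measureReal_def]
    field_simp
  rw [hlim] at key
  refine key.congr' ?_
  filter_upwards [eventually_ge_atTop 1] with Q hQ
  have hQ0 : NeZero Q := ⟨by omega⟩
  have hQ' : (0 : ℝ) < Q := by exact_mod_cast hQ
  congr 2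
  rw [Nat.card_coe_set_eq]
  symm
  refine Set.ncard_congr (fun p _ => ![(p.1 : ℝ) / (a * Q), (p.2 : ℝ) / (b * Q)]) ?_ ?_ ?_
  · rintro ⟨x, y⟩ ⟨⟨⟨x, rfl⟩, y, rfl⟩, hp⟩
    constructor
    · change ((a : ℝ) * _, (b : ℝ) * _) ∈ A
      simp only at hp
      convert hp using 2
      · simp; field_simp
      · simp; field_simp
    · rw [← Submodule.coe_pointwise_smul, SetLike.mem_coe,
      BoxIntegral.unitPartition.mem_smul_span_iff]
      intro i
      fin_cases i
      · exact ⟨x, by simp; field_simp⟩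
      · exact ⟨y, by simp; field_simp⟩
  · rintro ⟨x, y⟩ ⟨x', y'⟩ - - hxy
    have e0 := congrFun hxy 0
    have e1 := congrFun hxy 1
    simp only [Matrix.cons_val_zero, Matrix.cons_val_one] at e0 e1
    rw [div_left_inj' (by positivity)] at e0 e1
    exact Prod.ext (by exact_mod_cast e0) (by exact_mod_cast e1)
  · rintro v ⟨hv, hv'⟩
    rw [← Submodule.coe_pointwise_smul, SetLike.mem_coe,
      BoxIntegral.unitPartition.mem_smul_span_iff] at hv'
    obtain ⟨x, hx⟩ := hv' 0
    obtain ⟨y, hy⟩ := hv' 1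
    change ((a : ℝ) * v 0, (b : ℝ) * v 1) ∈ A at hv
    obtain ⟨⟨h1, -⟩, h3, -⟩ := hA.subset hv
    simp only at h1 h3
    have p0 : 0 < v 0 := pos_of_mul_pos_right h1 ha'.le
    have p1 : 0 < v 1 := pos_of_mul_pos_right h3 hb'.le
    -- The region lies in the open quadrant, so integer points of its dilates have natural
    -- coordinates.
    have hx0 : (0 : ℤ) ≤ x := by
      have : (0 : ℝ) ≤ x := by
        rw [show (x : ℝ) = Q * v 0 from hx]; positivity
      exact_mod_cast this
    have hy0 : (0 : ℤ) ≤ y := by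
      have : (0 : ℝ) ≤ y := by
        rw [show (y : ℝ) = Q * v 1 from hy]; positivity
      exact_mod_cast this
    lift x to ℕ using hx0
    lift y to ℕ using hy0
    simp only [algebraMap_int_eq, eq_intCast, Int.cast_natCast] at hx hy
    refine ⟨(a * x, b * y), ⟨⟨dvd_mul_right _ _, dvd_mul_right _ _⟩, ?_⟩, ?_⟩
    · convert hv using 2
      · simp [hx]; field_simp
      · simp [hy]; field_simp
    · ext i
      fin_cases i
      · simp [hx]; field_simp
      · simp [hy]; field_simp

theorem tendsto_ncard_latticeSet_congr {A : Set (ℝ × ℝ)} {C C' : ℕ × ℕ → Prop} {u : ℝ}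
    (h : ∀ p, C' p ↔ C p)
    (hC : Tendsto (fun Q : ℕ => ((latticeSet A C Q).ncard : ℝ) / Q ^ 2) atTop (𝓝 u)) :
    Tendsto (fun Q : ℕ => ((latticeSet A C' Q).ncard : ℝ) / Q ^ 2) atTop (𝓝 u) := by
  rwa [show C' = C from funext fun p => propext (h p)]

theorem JordanRegion.tendsto_and_not {A : Set (ℝ × ℝ)} (hA : JordanRegion A) {C D : ℕ × ℕ → Prop} {u w : ℝ}
    (hC : Tendsto (fun Q : ℕ => ((latticeSet A C Q).ncard : ℝ) / Q ^ 2) atTop (𝓝 u))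
    (hD : Tendsto (fun Q : ℕ => ((latticeSet A (fun p => C p ∧ D p) Q).ncard : ℝ) / Q ^ 2) atTop
      (𝓝 w)) :
    Tendsto (fun Q : ℕ => ((latticeSet A (fun p => C p ∧ ¬ D p) Q).ncard : ℝ) / Q ^ 2) atTop
      (𝓝 (u - w)) := by
  refine (hC.sub hD).congr fun Q => ?_
  have := Set.ncard_inter_add_ncard_sdiff_eq_ncard (latticeSet A C Q) {p | D p}
    (hA.latticeSet_finite C Q)
  have e1 : latticeSet A C Q ∩ {p | D p} = latticeSet A (fun p => C p ∧ D p) Q := by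
    ext p; simp only [latticeSet, Set.mem_inter_iff, Set.mem_ofPred_eq]; tauto
  have e2 : latticeSet A C Q \ {p | D p} = latticeSet A (fun p => C p ∧ ¬ D p) Q := by
    ext p; simp only [latticeSet, Set.mem_sdiff, Set.mem_ofPred_eq]; tauto
  rw [e1, e2] at this
  rw [← this]
  push_cast
  ring

/-! ### Parity classes and coprimality -/

/-- The points whose coordinates are multiples of `d`, with prescribed parities. -/
def parityMultiple (d e₁ e₂ : ℕ) (p : ℕ × ℕ) : Prop :=
  (d ∣ p.1 ∧ d ∣ p.2) ∧ p.1 ≡ e₁ [MOD 2] ∧ p.2 ≡ e₂ [MOD 2]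

/-- For odd `d`, evenness of a coordinate replaces `d` by `2 * d`, and oddness is obtained by
subtraction. All four classes receive the same share. -/
theorem tendsto_ncard_parityMultiple {A : Set (ℝ × ℝ)} (hA : JordanRegion A) {d e₁ e₂ : ℕ}
    (hd : Odd d) (h₁ : e₁ = 0 ∨ e₁ = 1) (h₂ : e₂ = 0 ∨ e₂ = 1) :
    Tendsto (fun Q : ℕ => ((latticeSet A (parityMultiple d e₁ e₂) Q).ncard : ℝ) / Q ^ 2) atTop
      (𝓝 (volume.real A * (1 / (4 * (d : ℝ) ^ 2)))) := by
  have hd0 : 0 < d := hd.pos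
  have hd' : (d : ℝ) ≠ 0 := by exact_mod_cast hd0.ne'
  have hdvd : ∀ n, 2 * d ∣ n ↔ d ∣ n ∧ 2 ∣ n := fun n =>
    ⟨fun h => ⟨(Dvd.intro_left _ rfl).trans h, (Dvd.intro _ rfl).trans h⟩,
      fun h => Nat.Coprime.mul_dvd_of_dvd_of_dvd (Nat.coprime_two_left.mpr hd) h.2 h.1⟩
  have t11 := tendsto_ncard_latticeSet_dvd hA hd0 hd0
  have t21 := tendsto_ncard_latticeSet_dvd hA (a := 2 * d) (by omega) hd0
  have t12 := tendsto_ncard_latticeSet_dvd hA (b := 2 * d) hd0 (by omega)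
  have t22 := tendsto_ncard_latticeSet_dvd hA (a := 2 * d) (b := 2 * d) (by omega) (by omega)
  have m0 : ∀ n, n ≡ 0 [MOD 2] ↔ 2 ∣ n := fun n => Nat.modEq_zero_iff_dvd
  have m1 : ∀ n, n ≡ 1 [MOD 2] ↔ ¬ 2 ∣ n := fun n => by
    rw [Nat.ModEq, Nat.dvd_iff_mod_eq_zero]; omega
  have s21 := tendsto_ncard_latticeSet_congr
    (C' := fun p : ℕ × ℕ => (d ∣ p.1 ∧ d ∣ p.2) ∧ 2 ∣ p.1) (fun p => by rw [hdvd]; tauto) t21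
  have s12 := tendsto_ncard_latticeSet_congr
    (C' := fun p : ℕ × ℕ => (d ∣ p.1 ∧ d ∣ p.2) ∧ 2 ∣ p.2) (fun p => by rw [hdvd]; tauto) t12
  have s22 := tendsto_ncard_latticeSet_congr
    (C' := fun p : ℕ × ℕ => ((d ∣ p.1 ∧ d ∣ p.2) ∧ 2 ∣ p.1) ∧ 2 ∣ p.2)
    (fun p => by rw [hdvd, hdvd]; tauto) t22
  have s22' := tendsto_ncard_latticeSet_congr
    (C' := fun p : ℕ × ℕ => ((d ∣ p.1 ∧ d ∣ p.2) ∧ 2 ∣ p.2) ∧ 2 ∣ p.1) (fun p => by tauto) s22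
  have n01 := hA.tendsto_and_not s21 s22
  have n10 := hA.tendsto_and_not s12 s22'
  have n1 := hA.tendsto_and_not t11 s21
  have n10' := tendsto_ncard_latticeSet_congr
    (C' := fun p : ℕ × ℕ => ((d ∣ p.1 ∧ d ∣ p.2) ∧ ¬ 2 ∣ p.1) ∧ 2 ∣ p.2) (fun p => by tauto) n10
  have n11 := hA.tendsto_and_not n1 n10'
  rcases h₁ with rfl | rfl <;> rcases h₂ with rfl | rfl
  · convert tendsto_ncard_latticeSet_congr (C' := parityMultiple d 0 0)
      (fun p => by rw [parityMultiple, m0, m0]; tauto) s22 using 2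
    push_cast; field_simp; norm_num
  · convert tendsto_ncard_latticeSet_congr (C' := parityMultiple d 0 1)
      (fun p => by rw [parityMultiple, m0, m1]; tauto) n01 using 2
    push_cast; field_simp; norm_num
  · convert tendsto_ncard_latticeSet_congr (C' := parityMultiple d 1 0)
      (fun p => by rw [parityMultiple, m0, m1]; tauto) n10 using 2
    push_cast; field_simp; norm_num
  · convert tendsto_ncard_latticeSet_congr (C' := parityMultiple d 1 1)
      (fun p => by rw [parityMultiple, m1, m1]; tauto) n11 using 2
    push_cast; field_simp; norm_num

open ArithmeticFunction in
-- The cutoff `N` is any bound for `m`, so that one range of summation serves all points of a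
-- dilated region.
theorem sum_moebius_dvd_gcd {m n N : ℕ} (hm : 1 ≤ m) (hN : m ≤ N) :
    (∑ d ∈ Finset.range (N + 1), if d ∣ m ∧ d ∣ n then moebius d else 0) =
      if Nat.Coprime m n then 1 else 0 := by
  have hg : Nat.gcd m n ≠ 0 := (Nat.gcd_pos_of_pos_left n hm).ne'
  have h := congrArg (fun f : ArithmeticFunction ℤ => f (Nat.gcd m n)) moebius_mul_coe_zeta
  simp only [coe_mul_zeta_apply, one_apply] at h
  simp only [Nat.coprime_iff_gcd_eq_one]
  rw [← h, ← Finset.sum_filter]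
  refine Finset.sum_congr ?_ fun _ _ => rfl
  ext d
  simp only [Finset.mem_filter, Finset.mem_range, Nat.mem_divisors, Nat.dvd_gcd_iff]
  constructor
  · exact fun hd => ⟨hd.2, hg⟩
  · exact fun hd => ⟨by have := Nat.le_of_dvd hm hd.1.1; omega, hd.1⟩

theorem not_parityMultiple_of_not_odd {d e₁ e₂ : ℕ} (he : e₁ = 1 ∨ e₂ = 1) (hd : ¬ Odd d) {p : ℕ × ℕ} :
    ¬ parityMultiple d e₁ e₂ p := by
  rintro ⟨⟨h1, h2⟩, h3, h4⟩
  rw [Nat.not_odd_iff_even, even_iff_two_dvd] at hd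
  have := hd.trans h1
  have := hd.trans h2
  rw [Nat.ModEq] at h3 h4
  omega

/-- The coprime points with prescribed parities. -/
def parityCoprime (e₁ e₂ : ℕ) (p : ℕ × ℕ) : Prop :=
  Nat.Coprime p.1 p.2 ∧ p.1 ≡ e₁ [MOD 2] ∧ p.2 ≡ e₂ [MOD 2]

open ArithmeticFunction in
theorem ncard_parityCoprime {A : Set (ℝ × ℝ)} (hA : JordanRegion A) (e₁ e₂ Q : ℕ) :
    ((latticeSet A (parityCoprime e₁ e₂) Q).ncard : ℝ) =
      ∑' d : ℕ, (moebius d : ℝ) * (latticeSet A (parityMultiple d e₁ e₂) Q).ncard := by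
  classical
  have hempty : ∀ d ∉ Finset.range (Q + 1), latticeSet A (parityMultiple d e₁ e₂) Q = ∅ := by
    intro d hd
    rw [Set.eq_empty_iff_forall_notMem]
    intro p hp
    obtain ⟨h1, h2, -⟩ := hA.mem_bounds hp
    have := Nat.le_of_dvd h1 hp.1.1.1
    simp at hd
    omega
  -- A divisor of a positive coordinate is at most `Q`, so the series is a finite sum; the form as a
  -- series over all `d` is what dominated convergence needs.
  rw [tsum_eq_sum (s := Finset.range (Q + 1)) fun d hd => by rw [hempty d hd]; simp]
  let S : Set (ℕ × ℕ) := latticeSet A (fun p => p.1 ≡ e₁ [MOD 2] ∧ p.2 ≡ e₂ [MOD 2]) Q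
  have hS : S.Finite := hA.latticeSet_finite _ Q
  have hcard : ∀ C : ℕ × ℕ → Prop,
      ((latticeSet A (fun p => C p ∧ p.1 ≡ e₁ [MOD 2] ∧ p.2 ≡ e₂ [MOD 2]) Q).ncard : ℤ) =
        ∑ p ∈ hS.toFinset, if C p then 1 else 0 := by
    intro C
    rw [← Finset.sum_filter, Finset.sum_const, nsmul_eq_mul, mul_one, Nat.cast_inj,
      ← Set.ncard_coe_finset]
    congr 1
    ext p
    simp only [latticeSet, Set.mem_ofPred_eq, Finset.coe_filter, Set.Finite.mem_toFinset, S]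
    tauto
  have key : ((latticeSet A (parityCoprime e₁ e₂) Q).ncard : ℤ) =
      ∑ d ∈ Finset.range (Q + 1), moebius d * (latticeSet A (parityMultiple d e₁ e₂) Q).ncard := by
    have h1 := hcard fun p => Nat.Coprime p.1 p.2
    have h2 := fun d => hcard fun p => d ∣ p.1 ∧ d ∣ p.2
    refine h1.trans (Eq.trans ?_ (Finset.sum_congr rfl fun d _ =>
      congrArg (ArithmeticFunction.moebius d * ·) (h2 d).symm))
    simp_rw [Finset.mul_sum]
    rw [Finset.sum_comm]
    refine Finset.sum_congr rfl fun p hp => ?_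
    obtain ⟨b1, b2, -⟩ := hA.mem_bounds (hS.mem_toFinset.mp hp)
    refine Eq.trans ?_ ((sum_moebius_dvd_gcd (n := p.2) b1 b2).symm.trans
      (Finset.sum_congr rfl fun d _ => ?_))
    · congr
    · by_cases hd : d ∣ p.1 ∧ d ∣ p.2 <;> simp [hd]
  exact_mod_cast congrArg (Int.cast : ℤ → ℝ) key

theorem ncard_parityMultiple_le {A : Set (ℝ × ℝ)} (hA : JordanRegion A) (d e₁ e₂ Q : ℕ) :
    (latticeSet A (parityMultiple d e₁ e₂) Q).ncard ≤ (Q / d) ^ 2 := by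
  have hsub : latticeSet A (parityMultiple d e₁ e₂) Q ⊆
      (((Finset.Icc 1 (Q / d)) ×ˢ (Finset.Icc 1 (Q / d))).image
        (fun p : ℕ × ℕ => (d * p.1, d * p.2)) : Finset (ℕ × ℕ)) := by
    rintro ⟨x, y⟩ hp
    obtain ⟨h1, h2, h3, h4⟩ := hA.mem_bounds hp
    obtain ⟨⟨x, rfl⟩, ⟨y, rfl⟩⟩ := hp.1.1
    simp only at h1 h2 h3 h4
    have hd : 0 < d := Nat.pos_of_mul_pos_right h1
    simp only [Finset.coe_image, Set.mem_image, Finset.mem_coe, Finset.mem_product, Finset.mem_Icc]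
    refine ⟨(x, y), ⟨⟨Nat.pos_of_mul_pos_left h1, ?_⟩, Nat.pos_of_mul_pos_left h3, ?_⟩, rfl⟩ <;>
    · rw [Nat.le_div_iff_mul_le hd, mul_comm]; assumption
  refine (Set.ncard_le_ncard hsub (Finset.finite_toSet _)).trans ?_
  rw [Set.ncard_coe_finset]
  refine Finset.card_image_le.trans ?_
  rw [Finset.card_product, Nat.card_Icc, Nat.add_sub_cancel, sq]

open Classical in
/-- The terms of the series for the density of the coprime points in an admissible parity class. -/
noncomputable def parityDensityTerm (d : ℕ) : ℝ :=
  if Odd d then (ArithmeticFunction.moebius d : ℝ) * (1 / (4 * (d : ℝ) ^ 2)) else 0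

/-- The density of the coprime points in an admissible parity class. -/
noncomputable def parityDensity : ℝ := ∑' d, parityDensityTerm d

theorem abs_moebius_cast_le_one (d : ℕ) : |(ArithmeticFunction.moebius d : ℝ)| ≤ 1 := by
  exact_mod_cast (ArithmeticFunction.abs_moebius_le_one (n := d))

/-- The count for `d`, divided by `Q ^ 2`, is at most `1 / d ^ 2`, so the limit may be taken
termwise. Even `d` contribute nothing because some coordinate is odd; this makes the limit
independent of the class. -/
theorem tendsto_ncard_parityCoprime {A : Set (ℝ × ℝ)} (hA : JordanRegion A) {e₁ e₂ : ℕ}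
    (h₁ : e₁ = 0 ∨ e₁ = 1) (h₂ : e₂ = 0 ∨ e₂ = 1) (he : e₁ = 1 ∨ e₂ = 1) :
    Tendsto (fun Q : ℕ => ((latticeSet A (parityCoprime e₁ e₂) Q).ncard : ℝ) / Q ^ 2) atTop
      (𝓝 (volume.real A * parityDensity)) := by
  rw [parityDensity, ← tsum_mul_left]
  have hs : Summable fun d : ℕ => 1 / (d : ℝ) ^ 2 := Real.summable_one_div_nat_pow.mpr one_lt_two
  refine (tendsto_tsum_of_dominated_convergence (f := fun (Q : ℕ) (d : ℕ) =>
    (ArithmeticFunction.moebius d : ℝ) *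
      (((latticeSet A (parityMultiple d e₁ e₂) Q).ncard : ℝ) / Q ^ 2)) hs ?_ ?_).congr ?_
  · intro d
    rw [parityDensityTerm]
    split_ifs with hd
    · rw [mul_left_comm]
      exact (tendsto_ncard_parityMultiple hA hd h₁ h₂).const_mul _
    · have : ∀ Q, latticeSet A (parityMultiple d e₁ e₂) Q = ∅ := fun Q => by
        rw [Set.eq_empty_iff_forall_notMem]
        exact fun p hp => not_parityMultiple_of_not_odd he hd hp.1
      simp [this]
  · filter_upwards [eventually_ge_atTop 1] with Q hQ d
    have hQ' : (0 : ℝ) < Q := by exact_mod_cast hQ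
    rw [norm_mul, Real.norm_eq_abs, Real.norm_eq_abs, abs_of_nonneg (a := _ / _) (by positivity)]
    refine (mul_le_of_le_one_left (by positivity) (abs_moebius_cast_le_one d)).trans ?_
    have h1 : ((latticeSet A (parityMultiple d e₁ e₂) Q).ncard : ℝ) ≤ ((Q / d : ℕ) : ℝ) ^ 2 := by
      exact_mod_cast ncard_parityMultiple_le hA d e₁ e₂ Q
    have h2 : ((Q / d : ℕ) : ℝ) ≤ (Q : ℝ) / d := Nat.cast_div_le
    have h3 : ((Q / d : ℕ) : ℝ) ^ 2 ≤ ((Q : ℝ) / d) ^ 2 := by gcongr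
    rw [div_le_iff₀ (by positivity)]
    calc _ ≤ _ := h1.trans h3
      _ = _ := by rw [div_pow]; ring
  · intro Q
    rw [ncard_parityCoprime hA, ← tsum_div_const]
    exact tsum_congr fun d => (mul_div_assoc _ _ _).symm

/-- Only positivity matters, since the density cancels. The term `d = 1` is 1/4, and the later ones
total at most `(π ^ 2 / 6 - 1) / 4` in absolute value, which is smaller because `π ^ 2 < 12`. -/
theorem parityDensity_pos : 0 < parityDensity := by
  have hs : Summable fun d : ℕ => 1 / (d : ℝ) ^ 2 := Real.summable_one_div_nat_pow.mpr one_lt_two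
  have hle : ∀ d : ℕ, |parityDensityTerm d| ≤ 1 / (4 : ℝ) * (1 / (d : ℝ) ^ 2) := by
    intro d
    rw [parityDensityTerm]
    split_ifs
    · rw [abs_mul, abs_of_nonneg (a := 1 / _) (by positivity), one_div_mul_one_div]
      exact mul_le_of_le_one_left (by positivity) (abs_moebius_cast_le_one d)
    · simp
  have hsum : Summable parityDensityTerm := .of_norm_bounded (hs.mul_left (1 / 4)) hle
  have h1 : parityDensityTerm 1 = 1 / 4 := by simp [parityDensityTerm]
  have h0 : parityDensityTerm 0 = 0 := by simp [parityDensityTerm]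
  have hz : HasSum (fun d : ℕ => 1 / (d : ℝ) ^ 2) (Real.pi ^ 2 / 6) := hasSum_zeta_two
  have htail := (hs.mul_left (1 / 4)).sum_add_tsum_nat_add 2
  have htail' := hsum.sum_add_tsum_nat_add 2
  rw [hz.mul_left (1 / 4) |>.tsum_eq] at htail
  simp only [Finset.sum_range_succ, Finset.sum_range_zero, h0, h1] at htail htail'
  have hb : |∑' d, parityDensityTerm (d + 2)| ≤
      ∑' d : ℕ, 1 / (4 : ℝ) * (1 / ((d + 2 : ℕ) : ℝ) ^ 2) :=
    tsum_of_norm_bounded (f := fun d => parityDensityTerm (d + 2)) ((summable_nat_add_iff 2).mpr (hs.mul_left (1 / 4))).hasSum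
      fun d => hle (d + 2)
  have hpi : Real.pi < 3.15 := Real.pi_lt_d2
  have hpi0 := Real.pi_pos
  have := neg_abs_le (∑' d, parityDensityTerm (d + 2))
  rw [parityDensity, ← htail']
  generalize ∑' d : ℕ, 1 / (4 : ℝ) * (1 / ((d + 2 : ℕ) : ℝ) ^ 2) = t at htail hb
  norm_num at htail
  nlinarith

/-! ### Geometry of the regions `T[k]` -/

/-- The triangle is invariant under `(x, y) ↦ (y, k * y - x)`: the floor condition on `k` says
exactly that `1 - y < k * y - x ≤ 1`. -/
theorem fareyL_bounds {x y : ℝ} (h : (x, y) ∈ fareyTriangle) (n : ℕ) :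
    0 < fareyL x y n ∧ fareyL x y n ≤ 1 ∧ 1 < fareyL x y n + fareyL x y (n + 1) := by
  obtain ⟨hx, hy, hxy⟩ := h
  simp only at hx hy hxy
  have key : ∀ n, fareyL x y n ≤ 1 ∧ fareyL x y (n + 1) ≤ 1 ∧
      1 < fareyL x y n + fareyL x y (n + 1) := by
    intro n
    induction n with
    | zero => exact ⟨hx, hy, hxy⟩
    | succ n ih =>
      obtain ⟨h1, h2, h3⟩ := ih
      have hpos : 0 < fareyL x y (n + 1) := by linarith
      have f1 := Int.floor_le ((1 + fareyL x y n) / fareyL x y (n + 1))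
      have f2 := Int.lt_floor_add_one ((1 + fareyL x y n) / fareyL x y (n + 1))
      rw [le_div_iff₀ hpos] at f1
      rw [div_lt_iff₀ hpos] at f2
      refine ⟨h2, ?_, ?_⟩ <;> rw [fareyL] <;> linarith
  obtain ⟨h1, h2, h3⟩ := key n
  exact ⟨by linarith, h1, h3⟩

/-- The coefficients depend on the point, but they are integers. An integral value of `(1 + L_{j-1})
/ L_j` thus puts the point on one of the countably many lines of `integralLines`. -/
theorem fareyL_eq_int_combination (x y : ℝ) (n : ℕ) :
    ∃ a b : ℤ, fareyL x y n = a * x + b * y := by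
  induction n using Nat.twoStepInduction with
  | zero => exact ⟨1, 0, by simp [fareyL]⟩
  | one => exact ⟨0, 1, by simp [fareyL]⟩
  | more n ih1 ih2 =>
    obtain ⟨a, b, h⟩ := ih1
    obtain ⟨a', b', h'⟩ := ih2
    rw [fareyL]
    refine ⟨⌊(1 + fareyL x y n) / fareyL x y (n + 1)⌋ * a' - a,
      ⌊(1 + fareyL x y n) / fareyL x y (n + 1)⌋ * b' - b, ?_⟩
    generalize ⌊(1 + fareyL x y n) / fareyL x y (n + 1)⌋ = k
    rw [h, h']
    push_cast
    ring

/-- The union of the lines `a x + b y = -1` with integers `a` and `b`. -/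
def integralLines : Set (ℝ × ℝ) := ⋃ ab : ℤ × ℤ, {p | (ab.1 : ℝ) * p.1 + ab.2 * p.2 = -1}

theorem volume_integralLines : volume integralLines = 0 := by
  refine measure_iUnion_null fun ⟨a, b⟩ => ?_
  have hm : MeasurableSet {p : ℝ × ℝ | (a : ℝ) * p.1 + b * p.2 = -1} :=
    measurableSet_eq_fun (by fun_prop) (by fun_prop)
  by_cases hb : b = 0
  · by_cases ha : a = 0
    -- With `a = b = 0` the equation reads `0 = -1` and has no solution.
    · simp [ha, hb]
    · have ha' : (a : ℝ) ≠ 0 := by exact_mod_cast ha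
      refine measure_mono_null (t := {-1 / (a : ℝ)} ×ˢ Set.univ) ?_ ?_
      · intro p hp
        simp only [hb, Int.cast_zero, zero_mul, add_zero, Set.mem_ofPred_eq] at hp
        refine ⟨?_, Set.mem_univ _⟩
        rw [Set.mem_singleton_iff, eq_div_iff ha', mul_comm, hp]
      · rw [Measure.volume_eq_prod, Measure.prod_prod, measure_singleton, zero_mul]
  · have hb' : (b : ℝ) ≠ 0 := by exact_mod_cast hb
    rw [Measure.volume_eq_prod, Measure.measure_prod_null hm]
    refine Eventually.of_forall fun x => ?_
    refine Set.Subsingleton.measure_zero (fun y hy z hz => ?_) _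
    simp only [Set.mem_preimage, Set.mem_ofPred_eq] at hy hz
    exact mul_left_cancel₀ hb' (by linarith)

theorem floor_arg_ne_int {p : ℝ × ℝ} (hp : p ∈ fareyTriangle) (hp' : p ∉ integralLines) (j : ℕ)
    (m : ℤ) : (1 + fareyL p.1 p.2 j) / fareyL p.1 p.2 (j + 1) ≠ m := by
  intro h
  have hpos := (fareyL_bounds (x := p.1) (y := p.2) hp (j + 1)).1
  rw [div_eq_iff hpos.ne'] at h
  obtain ⟨a, b, e⟩ := fareyL_eq_int_combination p.1 p.2 j
  obtain ⟨a', b', e'⟩ := fareyL_eq_int_combination p.1 p.2 (j + 1)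
  rw [e, e'] at h
  refine hp' (Set.mem_iUnion.mpr ⟨(a - m * a', b - m * b'), ?_⟩)
  simp only [Set.mem_ofPred_eq]
  push_cast
  linarith

theorem eventually_floor_eq {t : ℝ} (h : ∀ m : ℤ, t ≠ m) : ∀ᶠ s in 𝓝 t, ⌊s⌋ = ⌊t⌋ := by
  have h1 : (⌊t⌋ : ℝ) < t := lt_of_le_of_ne (Int.floor_le t) (h _).symm
  filter_upwards [Ioo_mem_nhds h1 (Int.lt_floor_add_one t)] with s hs
  exact Int.floor_eq_iff.mpr ⟨hs.1.le, hs.2⟩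

theorem eventually_fareyIndex_eq_of_continuousAt {p : ℝ × ℝ} (hp : p ∈ fareyTriangle)
    (hp' : p ∉ integralLines) {j : ℕ}
    (h : ContinuousAt (fun q : ℝ × ℝ => fareyL q.1 q.2 j) p)
    (h' : ContinuousAt (fun q : ℝ × ℝ => fareyL q.1 q.2 (j + 1)) p) :
    ∀ᶠ q in 𝓝 p, fareyIndex q.1 q.2 j = fareyIndex p.1 p.2 j := by
  have hpos := (fareyL_bounds (x := p.1) (y := p.2) hp (j + 1)).1
  have hc : ContinuousAt
      (fun q : ℝ × ℝ => (1 + fareyL q.1 q.2 j) / fareyL q.1 q.2 (j + 1)) p :=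
    (continuousAt_const.add h).div h' hpos.ne'
  exact hc.eventually (eventually_floor_eq (floor_arg_ne_int hp hp' j))

/-- Off the lines the next index is locally constant as soon as the two preceding values are
continuous, so the next value is locally a fixed combination of them. -/
theorem continuousAt_fareyL {p : ℝ × ℝ} (hp : p ∈ fareyTriangle) (hp' : p ∉ integralLines)
    (n : ℕ) : ContinuousAt (fun q : ℝ × ℝ => fareyL q.1 q.2 n) p := by
  induction n using Nat.twoStepInduction with
  | zero => exact continuousAt_fst
  | one => exact continuousAt_snd
  | more n ih1 ih2 =>
    have hev := eventually_fareyIndex_eq_of_continuousAt hp hp' ih1 ih2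
    refine ((ih2.const_mul (fareyIndex p.1 p.2 n : ℝ)).sub ih1).congr ?_
    filter_upwards [hev] with q hq
    rw [fareyL, ← hq, fareyIndex]
    rfl

theorem eventually_fareyIndex_eq {p : ℝ × ℝ} (hp : p ∈ fareyTriangle) (hp' : p ∉ integralLines)
    (j : ℕ) : ∀ᶠ q in 𝓝 p, fareyIndex q.1 q.2 j = fareyIndex p.1 p.2 j :=
  eventually_fareyIndex_eq_of_continuousAt hp hp' (continuousAt_fareyL hp hp' j)
    (continuousAt_fareyL hp hp' (j + 1))

theorem eventually_mem_fareyTriangle_iff {p : ℝ × ℝ} (hp : p ∉ integralLines) :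
    ∀ᶠ q in 𝓝 p, (q ∈ fareyTriangle ↔ p ∈ fareyTriangle) := by
  -- The three sides of the triangle are themselves among the lines.
  have h1 : p.1 ≠ 1 := fun h => hp (Set.mem_iUnion.mpr ⟨(-1, 0), by simp [h]⟩)
  have h2 : p.2 ≠ 1 := fun h => hp (Set.mem_iUnion.mpr ⟨(0, -1), by simp [h]⟩)
  have h3 : p.1 + p.2 ≠ 1 := fun h => hp (Set.mem_iUnion.mpr ⟨(-1, -1), by
    simp only [Set.mem_ofPred_eq]; push_cast; linarith⟩)
  have key : ∀ f : ℝ × ℝ → ℝ, Continuous f → f p ≠ 1 →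
      ∀ᶠ q in 𝓝 p, (f q < 1 ↔ f p < 1) ∧ f q ≠ 1 := by
    intro f hf hne
    rcases hne.lt_or_gt with h | h
    · filter_upwards [hf.continuousAt.eventually_lt_const h] with q hq
      exact ⟨iff_of_true hq h, hq.ne⟩
    · filter_upwards [hf.continuousAt.eventually_const_lt h] with q hq
      exact ⟨iff_of_false hq.not_gt h.not_gt, hq.ne'⟩
  filter_upwards [key _ continuous_fst h1, key _ continuous_snd h2,
    key (fun q => q.1 + q.2) (by fun_prop) h3] with q e1 e2 e3
  simp only [fareyTriangle, Set.mem_ofPred_eq]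
  rw [e1.2.le_iff_lt, e2.2.le_iff_lt, h1.le_iff_lt, h2.le_iff_lt, e1.1, e2.1,
    ← not_le (a := q.1 + q.2), ← not_le (a := p.1 + p.2), e3.2.le_iff_lt, h3.le_iff_lt, e3.1]

/-- The union of the regions `T[k]` with `k` in `S`. -/
def fareyRegionUnion {s : ℕ} (S : Set (Fin s → ℕ)) : Set (ℝ × ℝ) := ⋃ k : S, fareyRegion k.1

theorem fareyRegionUnion_subset {s : ℕ} (S : Set (Fin s → ℕ)) :
    fareyRegionUnion S ⊆ fareyTriangle :=
  Set.iUnion_subset fun _ _ h => h.1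

theorem frontier_subset_integralLines {A : Set (ℝ × ℝ)}
    (h : ∀ p ∉ integralLines, ∀ᶠ q in 𝓝 p, (q ∈ A ↔ p ∈ A)) : frontier A ⊆ integralLines := by
  intro p hp
  by_contra hp'
  have hev := h p hp'
  by_cases hA : p ∈ A
  · exact hp.2 (mem_interior_iff_mem_nhds.mpr (hev.mono fun q hq => hq.mpr hA))
  · have : p ∈ interior Aᶜ := mem_interior_iff_mem_nhds.mpr (hev.mono fun q hq => hq.not.mpr hA)
    rw [interior_compl] at this
    exact this hp.1

theorem measurable_fareyL (n : ℕ) : Measurable fun q : ℝ × ℝ => fareyL q.1 q.2 n := by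
  induction n using Nat.twoStepInduction with
  | zero => exact measurable_fst
  | one => exact measurable_snd
  | more n ih1 ih2 =>
    simp only [fareyL]
    have : Measurable fun q : ℝ × ℝ => ((⌊(1 + fareyL q.1 q.2 n) / fareyL q.1 q.2 (n + 1)⌋ : ℤ) : ℝ) :=
      (measurable_from_top (f := fun m : ℤ => (m : ℝ))).comp ((measurable_const.add ih1).div ih2).floor
    exact (this.mul ih2).sub ih1

theorem measurable_fareyIndex (j : ℕ) : Measurable fun q : ℝ × ℝ => fareyIndex q.1 q.2 j :=
  ((measurable_const.add (measurable_fareyL j)).div (measurable_fareyL (j + 1))).floor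

theorem measurableSet_fareyTriangle : MeasurableSet fareyTriangle :=
  (measurableSet_le measurable_fst measurable_const).inter
    ((measurableSet_le measurable_snd measurable_const).inter
      (measurableSet_lt measurable_const (measurable_fst.add measurable_snd)))

theorem measurableSet_fareyRegion {s : ℕ} (k : Fin s → ℕ) : MeasurableSet (fareyRegion k) := by
  refine measurableSet_fareyTriangle.inter ?_
  have : {p : ℝ × ℝ | ∀ j : Fin s, fareyIndex p.1 p.2 j = (k j : ℤ)} =
      ⋂ j : Fin s, {p | fareyIndex p.1 p.2 j = (k j : ℤ)} := by ext; simp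
  change MeasurableSet {p : ℝ × ℝ | ∀ j : Fin s, fareyIndex p.1 p.2 j = (k j : ℤ)}
  rw [this]
  exact MeasurableSet.iInter fun j => measurable_fareyIndex j (measurableSet_singleton _)

theorem fareyTriangle_subset_Ioc : fareyTriangle ⊆ Set.Ioc 0 1 ×ˢ Set.Ioc 0 1 := by
  rintro ⟨x, y⟩ ⟨h1, h2, h3⟩
  simp only at h1 h2 h3
  exact ⟨⟨by simp only; linarith, h1⟩, ⟨by simp only; linarith, h2⟩⟩

theorem jordanRegion_fareyTriangle : JordanRegion fareyTriangle where
  subset := fareyTriangle_subset_Ioc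
  measurable := measurableSet_fareyTriangle
  frontier := measure_mono_null
    (frontier_subset_integralLines fun _ hp => eventually_mem_fareyTriangle_iff hp)
    volume_integralLines

/-- An infinite union may have a large frontier in general. Here finitely many indices decide
membership and are all locally constant off the same null set of lines, whatever `S` is. -/
theorem jordanRegion_fareyRegionUnion {s : ℕ} (S : Set (Fin s → ℕ)) :
    JordanRegion (fareyRegionUnion S) where
  subset := (fareyRegionUnion_subset S).trans fareyTriangle_subset_Ioc
  measurable := MeasurableSet.iUnion fun k => measurableSet_fareyRegion k.1
  frontier := by
    refine measure_mono_null (frontier_subset_integralLines fun p hp => ?_) volume_integralLines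
    have hT := eventually_mem_fareyTriangle_iff hp
    by_cases h : p ∈ fareyTriangle
    · have hI : ∀ᶠ q in 𝓝 p, ∀ j : Fin s, fareyIndex q.1 q.2 j = fareyIndex p.1 p.2 j :=
        eventually_all.mpr fun j => eventually_fareyIndex_eq h hp j
      filter_upwards [hT, hI] with q h1 h2
      simp only [fareyRegionUnion, fareyRegion, Set.mem_iUnion, Set.mem_ofPred_eq, h1, h2]
    · filter_upwards [hT] with q h1
      exact iff_of_false (fun hq => h (h1.mp (fareyRegionUnion_subset S hq)))
        fun hq => h (fareyRegionUnion_subset S hq)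

theorem volume_fareyTriangle : volume fareyTriangle = ENNReal.ofReal (1 / 2) := by
  have hslice : ∀ x : ℝ, volume (Prod.mk x ⁻¹' fareyTriangle) =
      (Set.Ioc (0 : ℝ) 1).indicator (fun x => ENNReal.ofReal x) x := by
    intro x
    by_cases hx : x ∈ Set.Ioc (0 : ℝ) 1
    · rw [Set.indicator_of_mem hx]
      have : Prod.mk x ⁻¹' fareyTriangle = Set.Ioc (1 - x) 1 := by
        ext y
        simp only [fareyTriangle, Set.mem_preimage, Set.mem_ofPred_eq, Set.mem_Ioc]
        exact ⟨fun h => ⟨by linarith [h.2.2], h.2.1⟩, fun h => ⟨hx.2, h.2, by linarith [h.1]⟩⟩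
      rw [this, Real.volume_Ioc, sub_sub_cancel]
    · rw [Set.indicator_of_notMem hx]
      have : Prod.mk x ⁻¹' fareyTriangle = ∅ := by
        rw [Set.eq_empty_iff_forall_notMem]
        exact fun y hy => hx (fareyTriangle_subset_Ioc hy).1
      rw [this, measure_empty]
  rw [Measure.volume_eq_prod, Measure.prod_apply measurableSet_fareyTriangle]
  simp_rw [hslice]
  rw [lintegral_indicator measurableSet_Ioc, ← ofReal_integral_eq_lintegral_ofReal,
    ← intervalIntegral.integral_of_le zero_le_one, integral_id]
  · norm_num
  · exact (continuous_id.integrableOn_Icc (a := 0) (b := 1)).mono_set Set.Ioc_subset_Icc_self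
  · exact (ae_restrict_iff' measurableSet_Ioc).mpr (Eventually.of_forall fun x hx => hx.1.le)

/-- The regions are disjoint, since a point determines its indices, and they lie in a triangle of
finite area. -/
theorem summable_fareyArea_and_volume {s : ℕ} (S : Set (Fin s → ℕ)) :
    Summable (fun k : S => fareyArea (k : Fin s → ℕ)) ∧
      volume.real (fareyRegionUnion S) = ∑' k : S, fareyArea (k : Fin s → ℕ) := by
  have hdisj : Pairwise (Function.onFun Disjoint fun k : S => fareyRegion k.1) := by
    intro k l hkl
    refine Set.disjoint_left.mpr fun p hp hp' => hkl (Subtype.ext (funext fun j => ?_))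
    have := (hp.2 j).symm.trans (hp'.2 j)
    exact_mod_cast this
  have hU := measure_iUnion (μ := volume) hdisj fun k => measurableSet_fareyRegion k.1
  have hfin : ∑' k : S, volume (fareyRegion k.1) ≠ ⊤ := by
    rw [← hU]
    exact measure_ne_top_of_subset (fareyRegionUnion_subset S)
      (by rw [volume_fareyTriangle]; exact ENNReal.ofReal_ne_top)
  refine ⟨ENNReal.summable_toReal hfin, ?_⟩
  rw [measureReal_def, fareyRegionUnion, hU, ENNReal.tsum_toReal_eq fun k =>
    ENNReal.ne_top_of_tsum_ne_top hfin k]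
  rfl

/-! ### Denominators as scaled values of `fareyL` -/

theorem mem_generators_iff {Q : ℕ} (hQ : 1 ≤ Q) (p : ℕ × ℕ) :
    p ∈ generators Q ↔ Nat.Coprime p.1 p.2 ∧ ((p.1 : ℝ) / Q, (p.2 : ℝ) / Q) ∈ fareyTriangle := by
  have hQ' : (0 : ℝ) < Q := by exact_mod_cast hQ
  simp only [generators, fareyTriangle, Set.mem_ofPred_eq]
  rw [div_le_one hQ', div_le_one hQ', ← add_div, one_lt_div hQ', Nat.cast_le, Nat.cast_le]
  norm_cast
  tauto

theorem ediv_eq_floor_div {a b Q : ℝ} {m n : ℤ} {N : ℕ} (hN : 0 < Q) (hb : 0 < b)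
    (hQ : (N : ℝ) = Q) (hm : (m : ℝ) = Q * a) (hn : (n : ℝ) = Q * b) :
    (m + N) / n = ⌊(1 + a) / b⌋ := by
  have hn0 : 0 < n := by
    have : (0 : ℝ) < n := by rw [hn]; positivity
    exact_mod_cast this
  have h1 := Int.ediv_mul_le (m + N) hn0.ne'
  have h2 := Int.lt_ediv_add_one_mul_self (m + N) hn0
  generalize (m + N) / n = k at h1 h2
  have h1' : (k : ℝ) * n ≤ m + N := by exact_mod_cast h1
  have h2' : (m : ℝ) + N < (k + 1) * n := by exact_mod_cast h2
  rw [hm, hn, hQ] at h1' h2'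
  symm
  rw [Int.floor_eq_iff, le_div_iff₀ hb, div_lt_iff₀ hb]
  constructor
  · exact le_of_mul_le_mul_left (by linarith) hN
  · exact lt_of_mul_lt_mul_left (by linarith) hN.le

theorem generatedDen_eq {Q : ℕ} {p : ℕ × ℕ}
    (h : ((p.1 : ℝ) / Q, (p.2 : ℝ) / Q) ∈ fareyTriangle) (hQ : 1 ≤ Q) (n : ℕ) :
    (generatedDen Q p.1 p.2 n : ℝ) = Q * fareyL (p.1 / Q) (p.2 / Q) n := by
  have hQ' : (0 : ℝ) < Q := by exact_mod_cast hQ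
  induction n using Nat.twoStepInduction with
  | zero => simp only [generatedDen, fareyL]; push_cast; field_simp
  | one => simp only [generatedDen, fareyL]; push_cast; field_simp
  | more n ih1 ih2 =>
    rw [generatedDen, fareyL, ediv_eq_floor_div hQ' (fareyL_bounds h (n + 1)).1 rfl ih1 ih2]
    push_cast
    rw [ih1, ih2]
    ring

theorem generatedIndex_eq {Q : ℕ} {p : ℕ × ℕ}
    (h : ((p.1 : ℝ) / Q, (p.2 : ℝ) / Q) ∈ fareyTriangle) (hQ : 1 ≤ Q) (j : ℕ) :
    generatedIndex Q p.1 p.2 j = fareyIndex (p.1 / Q) (p.2 / Q) j :=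
  ediv_eq_floor_div (by exact_mod_cast hQ) (fareyL_bounds h (j + 1)).1 rfl
    (generatedDen_eq h hQ j) (generatedDen_eq h hQ (j + 1))

theorem fareyIndex_nonneg {x y : ℝ} (h : (x, y) ∈ fareyTriangle) (j : ℕ) :
    0 ≤ fareyIndex x y j := by
  have h0 := (fareyL_bounds h j).1
  have h1 := (fareyL_bounds h (j + 1)).1
  exact Int.floor_nonneg.mpr (by positivity)

theorem generatedDen_succ_succ (Q a b n : ℕ) : generatedDen Q a b (n + 2) =
    generatedIndex Q a b n * generatedDen Q a b (n + 1) - generatedDen Q a b n := rfl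

/-- Apart from the two initial values, the recursion involves only the indices, so it can be
compared modulo `d` even for different orders `Q` and `Q'`. -/
theorem generatedDen_modEq {Q Q' r : ℕ} {d : ℤ} {p p' : ℕ × ℕ}
    (h0 : (p.1 : ℤ) ≡ p'.1 [ZMOD d]) (h1 : (p.2 : ℤ) ≡ p'.2 [ZMOD d])
    (h : ∀ j < r, generatedIndex Q p.1 p.2 j = generatedIndex Q' p'.1 p'.2 j) (n : ℕ)
    (hn : n < r + 2) : generatedDen Q p.1 p.2 n ≡ generatedDen Q' p'.1 p'.2 n [ZMOD d] := by
  induction n using Nat.twoStepInduction with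
  | zero => exact h0
  | one => exact h1
  | more n ih1 ih2 =>
    rw [generatedDen_succ_succ, generatedDen_succ_succ, h n (by omega)]
    exact ((ih2 (by omega)).mul_left _).sub (ih1 (by omega))

/-- An index vector enters `parityIndices` through a single witness, possibly of another order. By
`generatedDen_modEq` every point with the same indices and initial parities then has the same
parities throughout, so the equality is exact. -/
theorem parityGenerators_eq_latticeSet {Q s : ℕ} (hQ : 1 ≤ Q) (c : Fin (s + 2) → ℕ) :
    parityGenerators Q 2 c =
      latticeSet (fareyRegionUnion (parityIndices 2 c)) (parityCoprime (c 0) (c 1)) Q := by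
  ext p
  constructor
  · rintro ⟨hp, hc⟩
    obtain ⟨hcop, hT⟩ := (mem_generators_iff hQ p).mp hp
    refine ⟨⟨hcop, Int.natCast_modEq_iff.mp (hc 0), Int.natCast_modEq_iff.mp (hc 1)⟩, ?_⟩
    have hnn : ∀ j : ℕ, ((fareyIndex (p.1 / Q) (p.2 / Q) j).toNat : ℤ) =
      fareyIndex (p.1 / Q) (p.2 / Q) j := fun j => Int.toNat_of_nonneg (fareyIndex_nonneg hT j)
    refine Set.mem_iUnion.mpr ⟨⟨fun j => (fareyIndex (p.1 / Q) (p.2 / Q) j).toNat,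
      Q, hQ, p, hp, fun j => ?_, hc⟩, hT, fun j => (hnn j).symm⟩
    rw [generatedIndex_eq hT hQ, hnn]
  · rintro ⟨⟨hcop, h0, h1⟩, hA⟩
    obtain ⟨⟨k, Q', hQ', p', hp', hk, hc⟩, hT, hj⟩ := Set.mem_iUnion.mp hA
    refine ⟨(mem_generators_iff hQ p).mpr ⟨hcop, hT⟩, fun i => ?_⟩
    refine (generatedDen_modEq (r := s) (Q' := Q') (p' := p') ?_ ?_ ?_ i i.2).trans (hc i)
    · exact (Int.natCast_modEq_iff.mpr h0).trans (hc 0).symm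
    · exact (Int.natCast_modEq_iff.mpr h1).trans (hc 1).symm
    · intro j hjs
      rw [generatedIndex_eq hT hQ]
      exact (hj ⟨j, hjs⟩).trans (hk ⟨j, hjs⟩).symm

/-! ### Limits of the proportions -/

theorem parityGenerators_pair {Q : ℕ} (hQ : 1 ≤ Q) (a b : ℕ) :
    parityGenerators Q 2 ![a, b] = latticeSet fareyTriangle (parityCoprime a b) Q := by
  ext p
  simp only [parityGenerators, latticeSet, parityCoprime, Set.mem_ofPred_eq, mem_generators_iff hQ,
    Fin.forall_fin_two]
  change _ ∧ ((p.1 : ℤ) ≡ (a : ℤ) [ZMOD (2 : ℕ)] ∧ (p.2 : ℤ) ≡ (b : ℤ) [ZMOD (2 : ℕ)]) ↔ _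
  rw [Int.natCast_modEq_iff, Int.natCast_modEq_iff]
  tauto

theorem not_parityCoprime_zero_zero (p : ℕ × ℕ) : ¬ parityCoprime 0 0 p := by
  rintro ⟨h, h0, h1⟩
  exact Nat.not_coprime_of_dvd_of_dvd one_lt_two (Nat.modEq_zero_iff_dvd.mp h0)
    (Nat.modEq_zero_iff_dvd.mp h1) h

theorem latticeSet_parityCoprime_zero_zero (A : Set (ℝ × ℝ)) (Q : ℕ) :
    latticeSet A (parityCoprime 0 0) Q = ∅ :=
  Set.eq_empty_iff_forall_notMem.mpr fun p hp => not_parityCoprime_zero_zero p hp.1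

theorem parityGenerators_finite (Q d : ℕ) {r : ℕ} (c : Fin r → ℕ) :
    (parityGenerators Q d c).Finite := (generators_finite Q).subset fun _ h => h.1

theorem ncard_split_parity {S : Set (ℕ × ℕ)} (hS : S.Finite) (f : ℕ × ℕ → ℕ) :
    S.ncard = {p ∈ S | f p ≡ 0 [MOD 2]}.ncard + {p ∈ S | f p ≡ 1 [MOD 2]}.ncard := by
  rw [← Set.ncard_inter_add_ncard_sdiff_eq_ncard S {p | f p ≡ 0 [MOD 2]} hS]
  congr 2
  ext p
  simp only [Set.mem_sdiff, Set.mem_ofPred_eq, Nat.ModEq]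
  exact and_congr_right fun _ => by omega

theorem ncard_parityGenerators_single {Q : ℕ} (a : ℕ) :
    (parityGenerators Q 2 ![a]).ncard =
      (parityGenerators Q 2 ![a, 0]).ncard + (parityGenerators Q 2 ![a, 1]).ncard := by
  rw [ncard_split_parity (parityGenerators_finite Q 2 ![a]) Prod.snd]
  congr 2 <;>
  · ext p
    simp only [parityGenerators, Set.mem_ofPred_eq, Fin.forall_fin_two, Fin.forall_fin_one]
    rw [← Int.natCast_modEq_iff, and_assoc]
    rfl

theorem ncard_generators {Q : ℕ} : (generators Q).ncard =
    (parityGenerators Q 2 ![0]).ncard + (parityGenerators Q 2 ![1]).ncard := by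
  rw [ncard_split_parity (generators_finite Q) Prod.fst]
  congr 2 <;>
  · ext p
    simp only [parityGenerators, Set.mem_ofPred_eq, Fin.forall_fin_one]
    rw [← Int.natCast_modEq_iff]
    rfl

theorem volume_real_fareyTriangle : volume.real fareyTriangle = 1 / 2 := by
  rw [measureReal_def, volume_fareyTriangle, ENNReal.toReal_ofReal (by norm_num)]

theorem tendsto_parityGenerators_pair {a b : ℕ} (ha : a = 0 ∨ a = 1) (hb : b = 0 ∨ b = 1)
    (hab : a = 1 ∨ b = 1) :
    Tendsto (fun Q : ℕ => ((parityGenerators Q 2 ![a, b]).ncard : ℝ) / Q ^ 2) atTop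
      (𝓝 (1 / 2 * parityDensity)) := by
  rw [← volume_real_fareyTriangle]
  refine (tendsto_ncard_parityCoprime jordanRegion_fareyTriangle ha hb hab).congr' ?_
  filter_upwards [eventually_ge_atTop 1] with Q hQ
  rw [parityGenerators_pair hQ]

theorem tendsto_parityGenerators_zero_zero :
    Tendsto (fun Q : ℕ => ((parityGenerators Q 2 ![0, 0]).ncard : ℝ) / Q ^ 2) atTop (𝓝 0) := by
  refine (tendsto_const_nhds (x := (0 : ℝ))).congr' ?_
  filter_upwards [eventually_ge_atTop 1] with Q hQ
  rw [parityGenerators_pair hQ, latticeSet_parityCoprime_zero_zero]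
  simp

theorem tendsto_parityGenerators_zero :
    Tendsto (fun Q : ℕ => ((parityGenerators Q 2 ![0]).ncard : ℝ) / Q ^ 2) atTop
      (𝓝 (1 / 2 * parityDensity)) := by
  have h := tendsto_parityGenerators_zero_zero.add
    (tendsto_parityGenerators_pair (a := 0) (b := 1) (by simp) (by simp) (by simp))
  rw [zero_add] at h
  refine h.congr fun Q => ?_
  rw [ncard_parityGenerators_single, Nat.cast_add, add_div]

theorem tendsto_parityGenerators_one :
    Tendsto (fun Q : ℕ => ((parityGenerators Q 2 ![1]).ncard : ℝ) / Q ^ 2) atTop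
      (𝓝 parityDensity) := by
  have h := (tendsto_parityGenerators_pair (a := 1) (b := 0) (by simp) (by simp) (by simp)).add
    (tendsto_parityGenerators_pair (a := 1) (b := 1) (by simp) (by simp) (by simp))
  rw [← add_mul, add_halves, one_mul] at h
  refine h.congr fun Q => ?_
  rw [ncard_parityGenerators_single, Nat.cast_add, add_div]

theorem tendsto_const_div_sq (a : ℝ) : Tendsto (fun Q : ℕ => a / (Q : ℝ) ^ 2) atTop (𝓝 0) :=
  tendsto_const_nhds.div_atTop
    ((tendsto_pow_atTop two_ne_zero).comp tendsto_natCast_atTop_atTop)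

theorem tendsto_ncard_fareySet_sub (a : ℝ) :
    Tendsto (fun Q : ℕ => (((fareySet Q).ncard : ℝ) - a) / Q ^ 2) atTop
      (𝓝 (3 / 2 * parityDensity)) := by
  -- The 1 in `1 - a` stands for the fraction 1, which starts no generator.
  have h := (tendsto_parityGenerators_zero.add tendsto_parityGenerators_one).add
    (tendsto_const_div_sq (1 - a))
  rw [add_zero, show 1 / 2 * parityDensity + parityDensity = 3 / 2 * parityDensity by ring] at h
  refine h.congr' ?_
  filter_upwards [eventually_ge_atTop 1] with Q hQ
  rw [ncard_fareySet_eq_generators hQ, ncard_generators]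
  push_cast
  ring

/-- Tuples and generators differ in number by a bounded amount, invisible after division by `Q ^ 2`;
the factor 2/3 is the inverse of the 3/2 in the size of the Farey sequence. -/
theorem tendsto_parityProportion {r : ℕ} (hr : 0 < r) {c : Fin r → ℕ} {v : ℝ}
    (h : Tendsto (fun Q : ℕ => ((parityGenerators Q 2 c).ncard : ℝ) / Q ^ 2) atTop
      (𝓝 (v * parityDensity))) :
    Tendsto (fun Q : ℕ => parityProportion Q 2 c) atTop (𝓝 (2 / 3 * v)) := by
  have hcount : Tendsto (fun Q : ℕ => (parityCount Q 2 c : ℝ) / Q ^ 2) atTop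
      (𝓝 (v * parityDensity)) := by
    have lo := h.sub (tendsto_const_div_sq r)
    have hi := h.add (tendsto_const_div_sq 1)
    rw [sub_zero] at lo
    rw [add_zero] at hi
    refine tendsto_of_tendsto_of_tendsto_of_le_of_le lo hi (fun Q => ?_) fun Q => ?_
    · have : ((parityGenerators Q 2 c).ncard : ℝ) ≤ parityCount Q 2 c + r := by
        exact_mod_cast le_parityCount hr c
      simp only
      rw [← sub_div]
      gcongr
      linarith
    · have : (parityCount Q 2 c : ℝ) ≤ (parityGenerators Q 2 c).ncard + 1 := by
        exact_mod_cast parityCount_le hr c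
      simp only
      rw [← add_div]
      gcongr
  have hpos := parityDensity_pos
  have key := hcount.div (tendsto_ncard_fareySet_sub ((r : ℝ) - 1)) (by positivity)
  rw [show v * parityDensity / (3 / 2 * parityDensity) = 2 / 3 * v by field_simp] at key
  refine key.congr' ?_
  filter_upwards [eventually_ge_atTop 1] with Q hQ
  have hQ' : (0 : ℝ) < Q := by exact_mod_cast hQ
  exact div_div_div_cancel_right₀ (by positivity) _ _

theorem tendsto_parityProportion_regionUnion {s : ℕ} {c : Fin (s + 2) → ℕ}
    (hc : ∀ i, c i = 0 ∨ c i = 1) :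
    Tendsto (fun Q : ℕ => parityProportion Q 2 c) atTop
      (𝓝 (2 / 3 * volume.real (fareyRegionUnion (parityIndices 2 c)))) := by
  refine tendsto_parityProportion (by omega) ?_
  by_cases h : c 0 = 1 ∨ c 1 = 1
  · refine (tendsto_ncard_parityCoprime (jordanRegion_fareyRegionUnion (parityIndices 2 c))
      (hc 0) (hc 1) h).congr' ?_
    filter_upwards [eventually_ge_atTop 1] with Q hQ
    rw [parityGenerators_eq_latticeSet hQ]
  · push Not at h
    have h0 : c 0 = 0 := (hc 0).resolve_right h.1
    have h1 : c 1 = 0 := (hc 1).resolve_right h.2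
    -- Two even initial denominators are never coprime, so both the count and the union of regions
    -- are empty.
    have hK : parityIndices 2 c = ∅ := by
      rw [Set.eq_empty_iff_forall_notMem]
      rintro k ⟨Q, hQ, p, hp, -, hd⟩
      refine not_parityCoprime_zero_zero p ⟨hp.2.2.2, ?_, ?_⟩
      · exact h0 ▸ Int.natCast_modEq_iff.mp (hd 0)
      · exact h1 ▸ Int.natCast_modEq_iff.mp (hd 1)
    have hU : volume.real (fareyRegionUnion (parityIndices 2 c)) = 0 := by
      simp [fareyRegionUnion, hK]
    rw [hU, zero_mul]
    refine (tendsto_const_nhds (x := (0 : ℝ))).congr' ?_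
    filter_upwards [eventually_ge_atTop 1] with Q hQ
    rw [parityGenerators_eq_latticeSet hQ, h0, h1, latticeSet_parityCoprime_zero_zero]
    simp

theorem tendsto_parityProportion_zero :
    Tendsto (fun Q : ℕ => parityProportion Q 2 ![0]) atTop (𝓝 (1 / 3)) := by
  have := tendsto_parityProportion one_pos tendsto_parityGenerators_zero
  norm_num at this ⊢
  exact this

theorem tendsto_parityProportion_one :
    Tendsto (fun Q : ℕ => parityProportion Q 2 ![1]) atTop (𝓝 (2 / 3)) := by
  have := tendsto_parityProportion (v := 1) one_pos
    (by simpa only [one_mul] using tendsto_parityGenerators_one)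
  rwa [mul_one] at this

theorem tendsto_parityProportion_pair {a b : ℕ} (ha : a = 0 ∨ a = 1) (hb : b = 0 ∨ b = 1)
    (hab : a = 1 ∨ b = 1) :
    Tendsto (fun Q : ℕ => parityProportion Q 2 ![a, b]) atTop (𝓝 (1 / 3)) := by
  have := tendsto_parityProportion two_pos (tendsto_parityGenerators_pair ha hb hab)
  norm_num at this ⊢
  exact this

theorem theorem4 :
    (∀ r : ℕ, 1 ≤ r → ∀ c : Fin r → ℕ, (∀ i, c i = 0 ∨ c i = 1) →
      ∃ ρ : ℝ, Tendsto (fun Q : ℕ => parityProportion Q 2 c) atTop (𝓝 ρ)) ∧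
    Tendsto (fun Q : ℕ => parityProportion Q 2 ![0]) atTop (𝓝 (1 / 3)) ∧
    Tendsto (fun Q : ℕ => parityProportion Q 2 ![1]) atTop (𝓝 (2 / 3)) ∧
    Tendsto (fun Q : ℕ => parityProportion Q 2 ![0, 1]) atTop (𝓝 (1 / 3)) ∧
    Tendsto (fun Q : ℕ => parityProportion Q 2 ![1, 0]) atTop (𝓝 (1 / 3)) ∧
    Tendsto (fun Q : ℕ => parityProportion Q 2 ![1, 1]) atTop (𝓝 (1 / 3)) ∧
    (∀ r : ℕ, 3 ≤ r → ∀ c : Fin r → ℕ, (∀ i, c i = 0 ∨ c i = 1) →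
      Summable (fun k : parityIndices 2 c => fareyArea (k : Fin (r - 2) → ℕ)) ∧
      Tendsto (fun Q : ℕ => parityProportion Q 2 c) atTop
        (𝓝 (2 / 3 * ∑' k : parityIndices 2 c, fareyArea (k : Fin (r - 2) → ℕ)))) := by
  refine ⟨fun r hr c hc => ?_, tendsto_parityProportion_zero, tendsto_parityProportion_one,
    tendsto_parityProportion_pair (by simp) (by simp) (by simp),
    tendsto_parityProportion_pair (by simp) (by simp) (by simp),
    tendsto_parityProportion_pair (by simp) (by simp) (by simp), fun r hr c hc => ?_⟩
  · match r, hr, c, hc with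
    | 1, _, c, hc =>
      rcases hc 0 with h | h
      · exact ⟨_, by
          rw [show c = ![0] from funext fun i => by rw [Subsingleton.elim i 0, h]; rfl]
          exact tendsto_parityProportion_zero⟩
      · exact ⟨_, by
          rw [show c = ![1] from funext fun i => by rw [Subsingleton.elim i 0, h]; rfl]
          exact tendsto_parityProportion_one⟩
    -- The case `r = 2` is included: the index vector is then empty.
    | s + 2, _, c, hc => exact ⟨_, tendsto_parityProportion_regionUnion hc⟩
  · obtain ⟨s, rfl⟩ : ∃ s, r = s + 2 := ⟨r - 2, by omega⟩
    obtain ⟨hsum, hvol⟩ := summable_fareyArea_and_volume (parityIndices 2 c)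
    refine ⟨hsum, ?_⟩
    rw [← hvol]
    exact tendsto_parityProportion_regionUnion hc
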